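/- Let $l\ge 2$, $r\ge 1$, $u\ge 1$ be integers and let $\gamma>0$ be a non-integer real number. Put $s=r+\lceil\gamma\rceil$, $\zeta=\lceil\gamma\rceil-\gamma$, $v=s/(s-\gamma)$. Let $\Omega=[-1,1]^l$, $\Gamma=\partial\Omega$, and let $d(t,\Gamma)$ be the $l_\infty$-distance from $t$ to $\Gamma$. The class $Q^u_{r\gamma}(\Omega,1)$ consists of the functions $f\in C^r(\Omega)$, $s$ times differentiable in $\Omega\setminus\Gamma$, such that $$\max_{t\in\Omega}|D^\alpha f(t)|\le 1\quad(0\le|\alpha|\le r),\qquad |D^\alpha f(t)|\le\frac{1+|\ln^u d(t,\Gamma)|}{d(t,\Gamma)^{|\alpha|-r-\zeta}}\quad(r<|\alpha|\le s,\ t\in\Omega\setminus\Gamma).$$ For a subset $X$ of a Banach space $B$ let $d_n(X,B)=\inf_{L}\sup_{x\in X}\inf_{y\in L}\|x-y\|$, where $L$ runs over the $n$-dimensional subspaces of $B$; $C=C(\Omega)$ carries the maximum norm. Assume $v>l/(l-1)$. Then there is a constant $c>0$, depending only on $l,r,u,\gamma$, such that the following two assertions hold. (1) For all integers $n\ge 2$,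 $$d_n(Q^u_{r\gamma}(\Omega,1),C)\le c\,n^{-(s-\gamma)/(l-1)}\ln^u n .$$ (2) This order is attained by continuous local splines. For every integer $N\ge2$, divide $\Omega$ into the layers $\Delta^k=\{t\in\Omega:(k/N)^v\le d(t,\Gamma)\le((k+1)/N)^v\}$, $0\le k\le N-1$, and put $h_k=((k+1)/N)^v-(k/N)^v$. Each $\Delta^k$ can be divided into finitely many boxes with disjoint interiors, edges parallel to the axes and edge lengths between $h_k$ and $2h_k$, so that $\Delta^{N-1}$ is a single box, the vertices of the boxes of $\Delta^{k+1}$ lying on the surface $d(t,\Gamma)=((k+1)/N)^v$ are vertices of boxes of $\Delta^k$ (for $k+1<N$), and the number $n$ of interpolation nodes, $s^l$ in each box, satisfies $$c^{-1}N^{v(l-1)}\le n\le cN^{v(l-1)},$$ and there is a linear operator $f\mapsto f_N^*$ on $C(\Omega)$ of rank at most $n$ with the following properties. On each box $f_N^*$ is a polynomial of degree at most $s-1$ in each variable. At each node of a box of $\Delta^k$ it equals $f$, except, when $k+1<N$, at the nodes on the surface $d(t,\Gamma)=((k+1)/N)^v$ between $\Delta^k$ and $\Delta^{k+1}$, where it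 takes the value of the spline on $\Delta^{k+1}$. Here the nodes of $[a_1,b_1]\times\cdots\times[a_l,b_l]$ are the products of the zeros $\cos\frac{(2j+1)\pi}{2s}$, $0\le j<s$, of the Chebyshev polynomial of degree $s$, mapped affinely in each variable so that the smallest zero goes to $a_i$ and the largest to $b_i$. Finally, $$\|f-f_N^*\|_{C(\Omega)}\le c\,n^{-(s-\gamma)/(l-1)}\ln^u n\qquad\text{for all } f\in Q^u_{r\gamma}(\Omega,1).$$ -/

import Mathlib

open scoped ENNReal

/-- The cube `Ω = [-1,1]^l`. The ambient space `Fin l → ℝ` carries the `l_∞` norm. -/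
abbrev cube (l : ℕ) : Set (Fin l → ℝ) :=
  Set.Icc (fun _ => (-1 : ℝ)) (fun _ => (1 : ℝ))

/-- `d(t,Γ)`: the `l_∞`-distance from `t` to the boundary `Γ` of the cube. -/
noncomputable def bdist {l : ℕ} (t : Fin l → ℝ) : ℝ :=
  Metric.infDist t (frontier (cube l))

/-- `s = r + ⌈γ⌉`. -/
noncomputable def smoothOrder (r : ℕ) (γ : ℝ) : ℕ := r + ⌈γ⌉₊

/-- `ζ = ⌈γ⌉ - γ`. -/
noncomputable def zetaPar (γ : ℝ) : ℝ := (⌈γ⌉₊ : ℝ) - γ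

/-- The grading exponent `v = s / (s - γ)`. -/
noncomputable def gradExp (r : ℕ) (γ : ℝ) : ℝ :=
  (smoothOrder r γ : ℝ) / ((smoothOrder r γ : ℝ) - γ)

/-- The directions of the partial derivative `∂^k / ∂t_{i 0} ⋯ ∂t_{i (k-1)}`. When `i` runs over all
maps `Fin k → Fin l`, these are all the partial derivatives `D^α` with `|α| = k`. -/
def coordDirs {l k : ℕ} (i : Fin k → Fin l) : Fin k → (Fin l → ℝ) :=
  fun j => Pi.single (i j) 1

/-- The class `Q^u_{rγ}(Ω,1)`, as a subset of `C(Ω)`: the functions in `C^r(Ω)` which are `s` times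
differentiable in `Ω \ Γ`, with all partial derivatives of order at most `r` bounded by `1` on `Ω`, and
those of order `r < k ≤ s` bounded by `(1 + |ln^u d(t,Γ)|) / d(t,Γ)^(k - r - ζ)` on `Ω \ Γ`. -/
def classQ (l r u : ℕ) (γ : ℝ) : Set C(cube l, ℝ) :=
  {g | ∃ f : (Fin l → ℝ) → ℝ,
    (∀ t : cube l, g t = f t) ∧
    ContDiffOn ℝ r f (cube l) ∧
    (∀ k ≤ r, ∀ i : Fin k → Fin l, ∀ t ∈ cube l,
      |iteratedFDerivWithin ℝ k f (cube l) t (coordDirs i)| ≤ 1) ∧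
    (∀ k < smoothOrder r γ,
      DifferentiableOn ℝ (iteratedFDeriv ℝ k f) (interior (cube l))) ∧
    (∀ k, r < k → k ≤ smoothOrder r γ → ∀ i : Fin k → Fin l, ∀ t ∈ interior (cube l),
      |iteratedFDeriv ℝ k f t (coordDirs i)| ≤
        (1 + |Real.log (bdist t) ^ u|) / bdist t ^ ((k : ℝ) - r - zetaPar γ))}

/-- The Kolmogorov width `d_n(X,B)`: the infimum over all `n`-dimensional subspaces `L` of `B` of
`sup_{x ∈ X} inf_{y ∈ L} ‖x - y‖`, as an element of `[0,∞]`. -/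
noncomputable def kolmogorovWidth {B : Type*} [NormedAddCommGroup B] [NormedSpace ℝ B]
    (n : ℕ) (X : Set B) : ℝ≥0∞ :=
  ⨅ (L : Submodule ℝ B) (_ : FiniteDimensional ℝ L ∧ Module.finrank ℝ L = n),
    ⨆ x ∈ X, ⨅ y ∈ L, ‖x - y‖ₑ

/-- The layer `Δ^k = {t ∈ Ω : (k/N)^v ≤ d(t,Γ) ≤ ((k+1)/N)^v}`. -/
def layer (l N : ℕ) (v : ℝ) (k : ℕ) : Set (Fin l → ℝ) :=
  {t | t ∈ cube l ∧ ((k : ℝ) / N) ^ v ≤ bdist t ∧ bdist t ≤ (((k : ℝ) + 1) / N) ^ v}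

/-- The width `h_k = ((k+1)/N)^v - (k/N)^v` of the layer `Δ^k`. -/
noncomputable def layerWidth (N : ℕ) (v : ℝ) (k : ℕ) : ℝ :=
  (((k : ℝ) + 1) / N) ^ v - ((k : ℝ) / N) ^ v

/-- `x` is a vertex of the box `[a_1,b_1] × ⋯ × [a_l,b_l]`, given as the pair `(a,b)`. -/
def IsBoxVertex {l : ℕ} (Q : (Fin l → ℝ) × (Fin l → ℝ)) (x : Fin l → ℝ) : Prop :=
  ∀ i, x i = Q.1 i ∨ x i = Q.2 i

/-- A graded layer partition of the cube: every layer `Δ^k`, `0 ≤ k < N`, is divided into finitely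
many boxes with edges parallel to the axes, whose edge lengths lie between `h_k` and `2 h_k`; the
central layer is a single box; and the vertices of the boxes of `Δ^{k+1}` which lie on the common
surface of `Δ^{k+1}` and `Δ^k` are vertices of boxes of `Δ^k`. A box is the pair of its lower and
upper corners. -/
structure GradedPartition (l N : ℕ) (v : ℝ) where
  boxes : ℕ → Finset ((Fin l → ℝ) × (Fin l → ℝ))
  edge_ge : ∀ k < N, ∀ Q ∈ boxes k, ∀ i, layerWidth N v k ≤ Q.2 i - Q.1 i
  edge_le : ∀ k < N, ∀ Q ∈ boxes k, ∀ i, Q.2 i - Q.1 i ≤ 2 * layerWidth N v k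
  cover : ∀ k < N, (⋃ Q ∈ boxes k, Set.Icc Q.1 Q.2) = layer l N v k
  disjoint : ∀ k < N, ∀ Q ∈ boxes k, ∀ Q' ∈ boxes k, Q ≠ Q' →
    Disjoint (interior (Set.Icc Q.1 Q.2)) (interior (Set.Icc Q'.1 Q'.2))
  central : ∀ k, k + 1 = N → (boxes k).card = 1
  vertices : ∀ k, k + 1 < N → ∀ Q ∈ boxes (k + 1), ∀ x, IsBoxVertex Q x →
    bdist x = (((k : ℝ) + 1) / N) ^ v → ∃ Q' ∈ boxes k, IsBoxVertex Q' x

/-- The number of interpolation nodes: `m^l` in each box. -/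
def GradedPartition.numNodes {l N : ℕ} {v : ℝ} (P : GradedPartition l N v) (m : ℕ) : ℕ :=
  m ^ l * ∑ k ∈ Finset.range N, (P.boxes k).card

/-- The zeros `cos ((2j+1)π/(2m))`, `0 ≤ j < m`, of the Chebyshev polynomial of the first kind of
degree `m`, transformed by the affine map which carries the largest zero to `b` and the smallest
zero to `a`. -/
noncomputable def chebNode (m : ℕ) (a b : ℝ) (j : Fin m) : ℝ :=
  (a + b) / 2 + (b - a) / 2 *
    (Real.cos ((2 * (j : ℝ) + 1) * Real.pi / (2 * m)) / Real.cos (Real.pi / (2 * m)))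

/-- `g` is the continuous local spline which interpolates `f` on the partition `P`: on each box it
is a polynomial of degree at most `m - 1` in each variable, and at each of the `m^l` tensor Chebyshev
nodes of a box of `Δ^k` it equals `f`, except at the nodes on the inner surface `Δ^k ∩ Δ^{k+1}`
(for `k + 1 < N`). At the latter nodes the polynomial takes the value of the spline already constructed
in `Δ^{k+1}`; this is the continuity of `g`, which is part of its type. -/
def IsInterpolatingSpline {l N : ℕ} {v : ℝ} (P : GradedPartition l N v) (m : ℕ)
    (f g : C(cube l, ℝ)) : Prop :=
  ∀ k < N, ∀ Q ∈ P.boxes k,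
    (∃ p ∈ MvPolynomial.restrictDegree (Fin l) ℝ (m - 1),
      ∀ t : cube l, (t : Fin l → ℝ) ∈ Set.Icc Q.1 Q.2 →
        g t = MvPolynomial.eval (t : Fin l → ℝ) p) ∧
    (∀ (j : Fin l → Fin m) (t : cube l),
      (t : Fin l → ℝ) = (fun i => chebNode m (Q.1 i) (Q.2 i) (j i)) →
      (k + 1 < N → bdist (t : Fin l → ℝ) ≠ (((k : ℝ) + 1) / N) ^ v) →
      g t = f t)

/-! The layers are graded so that every box carries an error of the same order. Since `s - r - ζ =
γ`, the derivatives of order `s` grow like `d^(-γ)`, up to the logarithm. For a box of `Δ^k` put `x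
= (k+1)/N`. Its edges are at most `2 h_k ≤ 2 v x^(v-1) / N`, and its centre has distance at least `δ
= x^v / 2` from `Γ`. The Taylor polynomial at the centre then has an error of order `h_k^s δ^(-γ) (1
+ |ln δ|)^u`, and `(v-1) s = v γ` leaves `N^(-s) ln^u N` (`layerWidth_pow_mul_le`). Boxes of `Δ^0`
touch `Γ`, where the derivatives blow up; the factor `(1-ξ)^(s-1)` of Cauchy's remainder compensates
`(1-ξ)^(-γ)` because `γ < s - 1` (`pow_mul_weight_le`, `abs_sub_taylorPoly_le`).

The layer `Δ^k` contains at most a constant times `N^(v(l-1)) (k+1)^(-(v-1)(l-1))` boxes. The sum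
over `k` converges because `v > l/(l-1)`, and `Δ^0` alone gives the lower bound, so `n` is of order
`N^(v(l-1))` and `N^(-s)` of order `n^(-(s-γ)/(l-1))` (`exists_numNodes_le`, `rpow_le_numNodes`).

The partition grows from the centre outwards; level `j` is the layer `k = N - 1 - j`. At each level
a one-dimensional grid is refined and receives one new cell at each end. The products of its cells
that contain an end cell as a factor form the layer. As the new grid refines the old one, tensor
interpolation on it reproduces the spline already built, so the spline extends continuously
(`spline_succ_of_norm_le`). On the outer surface of a layer the spline depends on values of `f`
alone (`spline_eq_boxInterp_of_norm_eq`), so errors pass through one interface only and do not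
accumulate over the `N` layers (`abs_sub_spline_le`). The range of the spline operator yields the
bound for the widths. -/

/-! ### Division of an interval into equal cells -/

/-- `m` consecutive intervals of length `w`, starting at `a`. -/
noncomputable def equalCells (a w : ℝ) (m : ℕ) : Finset (ℝ × ℝ) :=
  (Finset.range m).image fun i : ℕ => (a + i * w, a + (i + 1) * w)

lemma mem_equalCells {a w : ℝ} {m : ℕ} {I : ℝ × ℝ} :
    I ∈ equalCells a w m ↔ ∃ i < m, (a + i * w, a + (i + 1) * w) = I := by
  simp [equalCells]

lemma equalCells_injective {a w : ℝ} (hw : 0 < w) :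
    Function.Injective fun i : ℕ => ((a + i * w, a + (i + 1) * w) : ℝ × ℝ) := by
  intro i j h
  simp only [Prod.mk.injEq, add_right_inj, mul_eq_mul_right_iff, Nat.cast_inj] at h
  rcases h.1 with h | h
  · exact h
  · exact absurd h hw.ne'

lemma equalCells_separated {a w : ℝ} (hw : 0 < w) {m : ℕ} {I J : ℝ × ℝ}
    (hI : I ∈ equalCells a w m) (hJ : J ∈ equalCells a w m) (hIJ : I ≠ J) :
    I.2 ≤ J.1 ∨ J.2 ≤ I.1 := by
  obtain ⟨i, -, rfl⟩ := mem_equalCells.1 hI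
  obtain ⟨j, -, rfl⟩ := mem_equalCells.1 hJ
  rcases lt_trichotomy i j with h | h | h
  · left
    have : (i : ℝ) + 1 ≤ j := by exact_mod_cast h
    simp only
    nlinarith
  · exact absurd (by rw [h]) hIJ
  · right
    have : (j : ℝ) + 1 ≤ i := by exact_mod_cast h
    simp only
    nlinarith

lemma equalCells_subset {a w : ℝ} (hw : 0 < w) {m : ℕ} {I : ℝ × ℝ}
    (hI : I ∈ equalCells a w m) : a ≤ I.1 ∧ I.2 ≤ a + m * w := by
  obtain ⟨i, hi, rfl⟩ := mem_equalCells.1 hI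
  have : (i : ℝ) + 1 ≤ m := by exact_mod_cast hi
  have h0 : (0 : ℝ) ≤ i := i.cast_nonneg
  constructor
  · simp only
    nlinarith
  · simp only
    nlinarith

lemma exists_mem_equalCells {a w : ℝ} (hw : 0 < w) {m : ℕ} (hm : 0 < m) {t : ℝ}
    (ht : t ∈ Set.Icc a (a + m * w)) : ∃ I ∈ equalCells a w m, t ∈ Set.Icc I.1 I.2 := by
  -- At the right end the floor used below would give the nonexistent cell `m`.
  rcases eq_or_lt_of_le ht.2 with h | h
  · refine ⟨_, mem_equalCells.2 ⟨m - 1, by omega, rfl⟩, ?_⟩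
    have : ((m - 1 : ℕ) : ℝ) = m - 1 := by
      rw [Nat.cast_sub (by omega)]
      simp
    rw [this, h]
    constructor
    · simp only
      nlinarith
    · simp
  · have h0 : 0 ≤ (t - a) / w := div_nonneg (by linarith [ht.1]) hw.le
    refine ⟨_, mem_equalCells.2 ⟨⌊(t - a) / w⌋₊, ?_, rfl⟩, ?_, ?_⟩
    · rw [Nat.floor_lt h0, div_lt_iff₀ hw]
      linarith
    · have := Nat.floor_le h0
      rw [le_div_iff₀ hw] at this
      simp only
      linarith
    · have := (Nat.lt_floor_add_one ((t - a) / w)).le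
      rw [div_le_iff₀ hw] at this
      simp only
      linarith

lemma sum_length_equalCells {a w : ℝ} (hw : 0 < w) (m : ℕ) :
    ∑ I ∈ equalCells a w m, (I.2 - I.1) = m * w := by
  rw [equalCells, Finset.sum_image fun i _ j _ h => equalCells_injective hw h]
  simp only [add_sub_add_left_eq_sub, ← sub_mul, add_sub_cancel_left, one_mul]
  simp

/-- The division of an interval into the largest number of equal parts of length at least `h`. -/
noncomputable def subdivide (h : ℝ) (I : ℝ × ℝ) : Finset (ℝ × ℝ) :=
  equalCells I.1 ((I.2 - I.1) / ⌊(I.2 - I.1) / h⌋₊) ⌊(I.2 - I.1) / h⌋₊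

section subdivide

variable {h : ℝ} {I : ℝ × ℝ}

lemma subdivide_count_pos (h0 : 0 < h) (hI : h ≤ I.2 - I.1) : 0 < ⌊(I.2 - I.1) / h⌋₊ :=
  Nat.floor_pos.2 ((one_le_div h0).2 hI)

lemma subdivide_width_pos (h0 : 0 < h) (hI : h ≤ I.2 - I.1) :
    0 < (I.2 - I.1) / ⌊(I.2 - I.1) / h⌋₊ :=
  div_pos (h0.trans_le hI) (Nat.cast_pos.2 (subdivide_count_pos h0 hI))

lemma subdivide_count_mul_width (h0 : 0 < h) (hI : h ≤ I.2 - I.1) :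
    (⌊(I.2 - I.1) / h⌋₊ : ℝ) * ((I.2 - I.1) / ⌊(I.2 - I.1) / h⌋₊) = I.2 - I.1 :=
  mul_div_cancel₀ _ (Nat.cast_pos.2 (subdivide_count_pos h0 hI)).ne'

/-- For `L = I.2 - I.1` and `q = ⌊L / h⌋₊ ≥ 1` one has `q h ≤ L < (q + 1) h ≤ 2 q h`. -/
lemma subdivide_length (h0 : 0 < h) (hI : h ≤ I.2 - I.1) {J : ℝ × ℝ} (hJ : J ∈ subdivide h I) :
    h ≤ J.2 - J.1 ∧ J.2 - J.1 ≤ 2 * h := by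
  obtain ⟨i, -, rfl⟩ := mem_equalCells.1 hJ
  have hm : (1 : ℝ) ≤ ⌊(I.2 - I.1) / h⌋₊ := by exact_mod_cast subdivide_count_pos h0 hI
  have h1 := Nat.floor_le (div_nonneg (h0.le.trans hI) h0.le)
  have h2 := Nat.lt_floor_add_one ((I.2 - I.1) / h)
  rw [le_div_iff₀ h0] at h1
  rw [div_lt_iff₀ h0] at h2
  have h3 : ∀ x w : ℝ, (I.1 + (x + 1) * w) - (I.1 + x * w) = w := fun x w => by ring
  simp only [h3]
  rw [le_div_iff₀ (by linarith), div_le_iff₀ (by linarith)]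
  constructor <;> nlinarith

lemma subdivide_separated (h0 : 0 < h) (hI : h ≤ I.2 - I.1) {J K : ℝ × ℝ}
    (hJ : J ∈ subdivide h I) (hK : K ∈ subdivide h I) (hJK : J ≠ K) : J.2 ≤ K.1 ∨ K.2 ≤ J.1 :=
  equalCells_separated (subdivide_width_pos h0 hI) hJ hK hJK

lemma subdivide_subset (h0 : 0 < h) (hI : h ≤ I.2 - I.1) {J : ℝ × ℝ} (hJ : J ∈ subdivide h I) :
    I.1 ≤ J.1 ∧ J.2 ≤ I.2 := by
  have := equalCells_subset (subdivide_width_pos h0 hI) hJ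
  rw [subdivide_count_mul_width h0 hI] at this
  exact ⟨this.1, by linarith [this.2]⟩

lemma exists_mem_subdivide (h0 : 0 < h) (hI : h ≤ I.2 - I.1) {t : ℝ}
    (ht : t ∈ Set.Icc I.1 I.2) : ∃ J ∈ subdivide h I, t ∈ Set.Icc J.1 J.2 := by
  refine exists_mem_equalCells (subdivide_width_pos h0 hI) (subdivide_count_pos h0 hI) ?_
  rw [subdivide_count_mul_width h0 hI]
  exact ⟨ht.1, by linarith [ht.2]⟩

lemma sum_length_subdivide (h0 : 0 < h) (hI : h ≤ I.2 - I.1) :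
    ∑ J ∈ subdivide h I, (J.2 - J.1) = I.2 - I.1 := by
  rw [subdivide, sum_length_equalCells (subdivide_width_pos h0 hI),
    subdivide_count_mul_width h0 hI]

lemma exists_subdivide_fst_eq (h0 : 0 < h) (hI : h ≤ I.2 - I.1) :
    ∃ J ∈ subdivide h I, J.1 = I.1 :=
  ⟨_, mem_equalCells.2 ⟨0, subdivide_count_pos h0 hI, rfl⟩, by simp⟩

lemma exists_subdivide_snd_eq (h0 : 0 < h) (hI : h ≤ I.2 - I.1) :
    ∃ J ∈ subdivide h I, J.2 = I.2 := by
  have hm := subdivide_count_pos h0 hI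
  refine ⟨_, mem_equalCells.2 ⟨⌊(I.2 - I.1) / h⌋₊ - 1, by omega, rfl⟩, ?_⟩
  have := subdivide_count_mul_width h0 hI
  rw [Nat.cast_sub hm]
  simp only [Nat.cast_one, sub_add_cancel]
  linarith

end subdivide

/-! ### Nested one-dimensional grids -/

/-- The half-side of the cube which consists of the `p` innermost layers, of widths `η j`. -/
noncomputable def radius (η : ℕ → ℝ) (p : ℕ) : ℝ := ∑ j ∈ Finset.range p, η j

/-- The outermost cells in the one-dimensional partition of level `j`. -/
noncomputable def endCells (η : ℕ → ℝ) : ℕ → Finset (ℝ × ℝ)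
  | 0 => {(-radius η 1, radius η 1)}
  | j + 1 => {(-radius η (j + 2), -radius η (j + 1)), (radius η (j + 1), radius η (j + 2))}

/-- The one-dimensional partition of `[-radius η (j + 1), radius η (j + 1)]`: each level refines the
previous one and adds a cell at each end. -/
noncomputable def gridCells (η : ℕ → ℝ) : ℕ → Finset (ℝ × ℝ)
  | 0 => endCells η 0
  | j + 1 => endCells η (j + 1) ∪ (gridCells η j).biUnion (subdivide (η (j + 1)))

section grid

variable {η : ℕ → ℝ}

lemma radius_succ (p : ℕ) : radius η (p + 1) = radius η p + η p := Finset.sum_range_succ _ _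

lemma radius_zero : radius η 0 = 0 := by simp [radius]

lemma radius_strictMono (hη : ∀ j, 0 < η j) : StrictMono (radius η) :=
  strictMono_nat_of_lt_succ fun p => by rw [radius_succ]; linarith [hη p]

lemma radius_nonneg (hη : ∀ j, 0 < η j) (p : ℕ) : 0 ≤ radius η p :=
  radius_zero (η := η) ▸ (radius_strictMono hη).monotone p.zero_le

lemma endCells_subset_gridCells (j : ℕ) : endCells η j ⊆ gridCells η j := by
  cases j with
  | zero => exact subset_rfl
  | succ j => exact Finset.subset_union_left

lemma mem_gridCells_succ {j : ℕ} {I : ℝ × ℝ} : I ∈ gridCells η (j + 1) ↔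
    I ∈ endCells η (j + 1) ∨ ∃ J ∈ gridCells η j, I ∈ subdivide (η (j + 1)) J := by
  simp [gridCells]

lemma mem_endCells_succ {j : ℕ} {I : ℝ × ℝ} : I ∈ endCells η (j + 1) ↔
    I = (-radius η (j + 2), -radius η (j + 1)) ∨ I = (radius η (j + 1), radius η (j + 2)) := by
  simp [endCells]

lemma mem_endCells_zero {I : ℝ × ℝ} : I ∈ endCells η 0 ↔ I = (-η 0, η 0) := by
  simp [endCells, radius]

lemma gridCells_length (hη : ∀ j, 0 < η j) (hanti : Antitone η) (j : ℕ) :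
    ∀ I ∈ gridCells η j, η j ≤ I.2 - I.1 ∧ I.2 - I.1 ≤ 2 * η j := by
  induction j with
  | zero =>
    intro I hI
    rw [mem_endCells_zero.1 hI]
    constructor <;> simp only <;> linarith [hη 0]
  | succ j ih =>
    intro I hI
    rcases mem_gridCells_succ.1 hI with h | ⟨J, hJ, h⟩
    · have h1 := hη (j + 1)
      rcases mem_endCells_succ.1 h with rfl | rfl <;> simp only [radius_succ (j + 1)] <;>
        constructor <;> linarith
    · exact subdivide_length (hη _) ((hanti j.le_succ).trans (ih J hJ).1) h

lemma gridCells_lt (hη : ∀ j, 0 < η j) (hanti : Antitone η) {j : ℕ} {I : ℝ × ℝ}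
    (hI : I ∈ gridCells η j) : I.1 < I.2 := by
  linarith [(gridCells_length hη hanti j I hI).1, hη j]

lemma le_length_of_mem_gridCells (hη : ∀ j, 0 < η j) (hanti : Antitone η) {j : ℕ} {I : ℝ × ℝ}
    (hI : I ∈ gridCells η j) : η (j + 1) ≤ I.2 - I.1 :=
  (hanti j.le_succ).trans (gridCells_length hη hanti j I hI).1

lemma gridCells_bounds (hη : ∀ j, 0 < η j) (hanti : Antitone η) (j : ℕ) :
    ∀ I ∈ gridCells η j, -radius η (j + 1) ≤ I.1 ∧ I.2 ≤ radius η (j + 1) := by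
  induction j with
  | zero =>
    intro I hI
    rw [mem_endCells_zero.1 hI]
    simp [radius]
  | succ j ih =>
    intro I hI
    have h1 := hη (j + 1)
    have h2 := radius_succ (η := η) (j + 1)
    have h3 := radius_nonneg hη (j + 1)
    rcases mem_gridCells_succ.1 hI with h | ⟨J, hJ, h⟩
    · rcases mem_endCells_succ.1 h with rfl | rfl
      · exact ⟨le_rfl, by simp only; linarith⟩
      · exact ⟨by simp only; linarith, le_rfl⟩
    · have := subdivide_subset (hη _) (le_length_of_mem_gridCells hη hanti hJ) h
      have := ih J hJ
      constructor <;> linarith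

lemma gridCells_separated (hη : ∀ j, 0 < η j) (hanti : Antitone η) (j : ℕ) :
    ∀ I ∈ gridCells η j, ∀ J ∈ gridCells η j, I ≠ J → I.2 ≤ J.1 ∨ J.2 ≤ I.1 := by
  induction j with
  | zero =>
    intro I hI J hJ hIJ
    exact absurd ((mem_endCells_zero.1 hI).trans (mem_endCells_zero.1 hJ).symm) hIJ
  | succ j ih =>
    have h0 := radius_nonneg hη (j + 1)
    have key : ∀ I ∈ endCells η (j + 1), ∀ J ∈ gridCells η j, ∀ K ∈ subdivide (η (j + 1)) J,
        I.2 ≤ K.1 ∨ K.2 ≤ I.1 := by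
      intro I hI J hJ K hK
      have h1 := subdivide_subset (hη _) (le_length_of_mem_gridCells hη hanti hJ) hK
      have h2 := gridCells_bounds hη hanti j J hJ
      rcases mem_endCells_succ.1 hI with rfl | rfl
      · left; simp only; linarith
      · right; simp only; linarith
    intro I hI J hJ hIJ
    rcases mem_gridCells_succ.1 hI with hI | ⟨I', hI', hI⟩ <;>
      rcases mem_gridCells_succ.1 hJ with hJ | ⟨J', hJ', hJ⟩
    · rcases mem_endCells_succ.1 hI with rfl | rfl <;>
        rcases mem_endCells_succ.1 hJ with rfl | rfl
      · exact absurd rfl hIJ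
      · left; simp only; linarith
      · right; simp only; linarith
      · exact absurd rfl hIJ
    · exact key I hI J' hJ' J hJ
    · exact (key J hJ I' hI' I hI).symm
    · by_cases h : I' = J'
      · subst h
        exact subdivide_separated (hη _) (le_length_of_mem_gridCells hη hanti hI') hI hJ hIJ
      · have h1 := subdivide_subset (hη _) (le_length_of_mem_gridCells hη hanti hI') hI
        have h2 := subdivide_subset (hη _) (le_length_of_mem_gridCells hη hanti hJ') hJ
        rcases ih I' hI' J' hJ' h with h | h
        · left; linarith
        · right; linarith

lemma exists_mem_endCells {j : ℕ} {t : ℝ} (h1 : radius η j ≤ |t|) (h2 : |t| ≤ radius η (j + 1)) :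
    ∃ I ∈ endCells η j, t ∈ Set.Icc I.1 I.2 := by
  cases j with
  | zero =>
    refine ⟨_, mem_endCells_zero.2 rfl, ?_⟩
    simpa [radius, abs_le] using h2
  | succ j =>
    rcases le_total 0 t with h | h
    · rw [abs_of_nonneg h] at h1 h2
      exact ⟨_, mem_endCells_succ.2 (Or.inr rfl), h1, h2⟩
    · rw [abs_of_nonpos h] at h1 h2
      exact ⟨_, mem_endCells_succ.2 (Or.inl rfl), by simp only; linarith, by simp only; linarith⟩

lemma exists_mem_gridCells (hη : ∀ j, 0 < η j) (hanti : Antitone η) (j : ℕ) :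
    ∀ t : ℝ, |t| ≤ radius η (j + 1) → ∃ I ∈ gridCells η j, t ∈ Set.Icc I.1 I.2 := by
  induction j with
  | zero =>
    intro t ht
    exact exists_mem_endCells (by rw [radius_zero]; exact abs_nonneg t) ht
  | succ j ih =>
    intro t ht
    rcases le_total |t| (radius η (j + 1)) with h | h
    · obtain ⟨J, hJ, htJ⟩ := ih t h
      obtain ⟨I, hI, htI⟩ :=
        exists_mem_subdivide (hη _) (le_length_of_mem_gridCells hη hanti hJ) htJ
      exact ⟨I, mem_gridCells_succ.2 (Or.inr ⟨J, hJ, hI⟩), htI⟩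
    · obtain ⟨I, hI, htI⟩ := exists_mem_endCells h ht
      exact ⟨I, endCells_subset_gridCells _ hI, htI⟩

lemma abs_le_of_mem_gridCells (hη : ∀ j, 0 < η j) (hanti : Antitone η) {j : ℕ} {I : ℝ × ℝ}
    (hI : I ∈ gridCells η j) {t : ℝ} (ht : t ∈ Set.Icc I.1 I.2) : |t| ≤ radius η (j + 1) := by
  have := gridCells_bounds hη hanti j I hI
  rw [abs_le]
  constructor <;> linarith [ht.1, ht.2]

lemma le_abs_of_mem_endCells {j : ℕ} {I : ℝ × ℝ} (hI : I ∈ endCells η j)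
    {t : ℝ} (ht : t ∈ Set.Icc I.1 I.2) : radius η j ≤ |t| := by
  cases j with
  | zero => rw [radius_zero]; exact abs_nonneg t
  | succ j =>
    rcases mem_endCells_succ.1 hI with rfl | rfl
    · exact le_abs.2 (Or.inr (by linarith [ht.2]))
    · exact le_abs.2 (Or.inl ht.1)

/-- An end cell attains the bound from level one on, and every other cell lies within `radius η j`.
Through this the centre of a box stays away from `Γ` even in the outermost layer. -/
lemma abs_midpoint_le (hη : ∀ j, 0 < η j) (hanti : Antitone η) {j : ℕ} {I : ℝ × ℝ}
    (hI : I ∈ gridCells η j) : |(I.1 + I.2) / 2| ≤ (radius η j + radius η (j + 1)) / 2 := by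
  have h0 := radius_nonneg hη j
  have h1 := radius_strictMono hη j.lt_succ_self
  cases j with
  | zero =>
    rw [mem_endCells_zero.1 hI]
    simp only [neg_add_cancel, zero_div, abs_zero]
    linarith
  | succ j =>
    rcases mem_gridCells_succ.1 hI with h | ⟨J, hJ, h⟩
    · rcases mem_endCells_succ.1 h with rfl | rfl
      · rw [abs_le]; constructor <;> simp only <;> linarith
      · rw [abs_le]; constructor <;> simp only <;> linarith
    · have h2 := subdivide_subset (hη _) (le_length_of_mem_gridCells hη hanti hJ) h
      have h3 := gridCells_bounds hη hanti j J hJ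
      have h4 := gridCells_lt hη hanti hI
      rw [abs_le]; constructor <;> linarith

/-- Together with the bounds on a single length this counts the cells up to a factor `2`. -/
lemma sum_length_gridCells (hη : ∀ j, 0 < η j) (hanti : Antitone η) (j : ℕ) :
    ∑ I ∈ gridCells η j, (I.2 - I.1) = 2 * radius η (j + 1) := by
  induction j with
  | zero => simp [gridCells, endCells]; ring
  | succ j ih =>
    have hlt : ∀ J ∈ gridCells η j, ∀ I ∈ subdivide (η (j + 1)) J, I.1 < I.2 := fun J hJ I hI =>
      gridCells_lt hη hanti (mem_gridCells_succ.2 (Or.inr ⟨J, hJ, hI⟩))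
    have hr := radius_succ (η := η) (j + 1)
    have hr0 := hη (j + 1)
    have h0 := radius_strictMono hη j.lt_succ_self
    have h00 := radius_nonneg hη j
    rw [gridCells, Finset.sum_union, Finset.sum_biUnion, Finset.sum_congr rfl fun J hJ =>
      sum_length_subdivide (hη _) (le_length_of_mem_gridCells hη hanti hJ), ih, endCells,
      Finset.sum_pair]
    · simp only
      linarith
    · intro h
      simp only [Prod.mk.injEq] at h
      linarith [h.1]
    · intro J hJ K hK hJK
      rw [Function.onFun, Finset.disjoint_left]
      intro I hI hI'
      have h1 := subdivide_subset (hη _) (le_length_of_mem_gridCells hη hanti hJ) hI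
      have h2 := subdivide_subset (hη _) (le_length_of_mem_gridCells hη hanti hK) hI'
      have h3 := hlt J hJ I hI
      rcases gridCells_separated hη hanti j J hJ K hK hJK with h | h <;> linarith
    · rw [Finset.disjoint_left]
      intro I hI hI'
      obtain ⟨J, hJ, hIJ⟩ := Finset.mem_biUnion.1 hI'
      have h1 := subdivide_subset (hη _) (le_length_of_mem_gridCells hη hanti hJ) hIJ
      have h2 := gridCells_bounds hη hanti j J hJ
      have h3 := hlt J hJ I hIJ
      rcases mem_endCells_succ.1 hI with rfl | rfl
      · simp only at h1 h3; linarith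
      · simp only at h1 h3; linarith

lemma card_gridCells_mul_le (hη : ∀ j, 0 < η j) (hanti : Antitone η) (j : ℕ) :
    ((gridCells η j).card : ℝ) * η j ≤ 2 * radius η (j + 1) := by
  rw [← sum_length_gridCells hη hanti, ← nsmul_eq_mul]
  exact Finset.card_nsmul_le_sum _ _ _ fun I hI => (gridCells_length hη hanti j I hI).1

lemma le_card_gridCells_mul (hη : ∀ j, 0 < η j) (hanti : Antitone η) (j : ℕ) :
    radius η (j + 1) ≤ ((gridCells η j).card : ℝ) * η j := by
  have := Finset.sum_le_card_nsmul (gridCells η j) (fun I => I.2 - I.1) (2 * η j)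
    fun I hI => (gridCells_length hη hanti j I hI).2
  rw [sum_length_gridCells hη hanti, nsmul_eq_mul] at this
  linarith

/-- The endpoints of the cells persist in the next level. -/
lemma exists_endpoint_gridCells_succ (hη : ∀ j, 0 < η j) (hanti : Antitone η) {j : ℕ}
    {I : ℝ × ℝ} (hI : I ∈ gridCells η j) {x : ℝ} (hx : x = I.1 ∨ x = I.2) :
    ∃ J ∈ gridCells η (j + 1), x = J.1 ∨ x = J.2 := by
  have hl := le_length_of_mem_gridCells hη hanti hI
  rcases hx with rfl | rfl
  · obtain ⟨J, hJ, h⟩ := exists_subdivide_fst_eq (hη _) hl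
    exact ⟨J, mem_gridCells_succ.2 (Or.inr ⟨I, hI, hJ⟩), Or.inl h.symm⟩
  · obtain ⟨J, hJ, h⟩ := exists_subdivide_snd_eq (hη _) hl
    exact ⟨J, mem_gridCells_succ.2 (Or.inr ⟨I, hI, hJ⟩), Or.inr h.symm⟩

lemma exists_endpoint_endCells_succ {j : ℕ} {x : ℝ} (hx : |x| = radius η (j + 1)) :
    ∃ J ∈ endCells η (j + 1), x = J.1 ∨ x = J.2 := by
  rcases eq_or_eq_neg_of_abs_eq hx with h | h
  · exact ⟨_, mem_endCells_succ.2 (Or.inr rfl), Or.inl h⟩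
  · exact ⟨_, mem_endCells_succ.2 (Or.inl rfl), Or.inr h⟩

lemma card_endCells_le (j : ℕ) : (endCells η j).card ≤ 2 := by
  cases j with
  | zero => simp [endCells]
  | succ j => exact Finset.card_le_two

lemma endCells_nonempty (j : ℕ) : (endCells η j).Nonempty := by
  cases j <;> simp [endCells]

end grid

/-! ### Stretched Chebyshev nodes and their Lagrange basis -/

section chebyshev

variable {m : ℕ}

/-- The Chebyshev nodes of the reference interval `[-1,1]`. -/
noncomputable def chebRef (m : ℕ) (j : Fin m) : ℝ :=
  Real.cos ((2 * (j : ℝ) + 1) * Real.pi / (2 * m)) / Real.cos (Real.pi / (2 * m))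

lemma chebNode_eq (a b : ℝ) (j : Fin m) :
    chebNode m a b j = (a + b) / 2 + (b - a) / 2 * chebRef m j := rfl

lemma cos_pi_div_two_mul_pos (hm : 2 ≤ m) : 0 < Real.cos (Real.pi / (2 * m)) := by
  have hm' : (2 : ℝ) ≤ m := by exact_mod_cast hm
  have hpi := Real.pi_pos
  refine Real.cos_pos_of_mem_Ioo ⟨?_, ?_⟩
  · have : 0 < Real.pi / (2 * m) := by positivity
    linarith
  · rw [div_lt_div_iff₀ (by positivity) (by positivity)]
    nlinarith

lemma chebAngle_mem (j : Fin m) :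
    (2 * (j : ℝ) + 1) * Real.pi / (2 * m) ∈ Set.Icc 0 Real.pi := by
  have hj : ((j : ℕ) : ℝ) + 1 ≤ m := by exact_mod_cast j.2
  have h0 : (0 : ℝ) ≤ (j : ℕ) := Nat.cast_nonneg _
  have hm : (0 : ℝ) < m := by linarith
  have hpi := Real.pi_pos
  refine ⟨by positivity, ?_⟩
  rw [div_le_iff₀ (by positivity)]
  nlinarith

lemma chebRef_injective (hm : 2 ≤ m) : Function.Injective (chebRef m) := by
  intro i j h
  have hm' : (0 : ℝ) < m := by exact_mod_cast (by omega : 0 < m)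
  rw [chebRef, chebRef, div_left_inj' (cos_pi_div_two_mul_pos hm).ne'] at h
  have := Real.injOn_cos (chebAngle_mem i) (chebAngle_mem j) h
  rw [div_left_inj' (by positivity), mul_left_inj' Real.pi_ne_zero] at this
  exact Fin.ext (by exact_mod_cast (by linarith : ((i : ℕ) : ℝ) = (j : ℕ)))

lemma exists_chebRef_eq_one (hm : 2 ≤ m) : ∃ j, chebRef m j = 1 := by
  refine ⟨⟨0, by omega⟩, ?_⟩
  simp [chebRef, (cos_pi_div_two_mul_pos hm).ne']

lemma exists_chebRef_eq_neg_one (hm : 2 ≤ m) : ∃ j, chebRef m j = -1 := by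
  refine ⟨⟨m - 1, by omega⟩, ?_⟩
  have hm' : (m : ℝ) ≠ 0 := by exact_mod_cast (by omega : m ≠ 0)
  have : (2 * ((m - 1 : ℕ) : ℝ) + 1) * Real.pi / (2 * m) = Real.pi - Real.pi / (2 * m) := by
    rw [Nat.cast_sub (by omega)]
    field_simp
    push_cast
    ring
  rw [chebRef, this, Real.cos_pi_sub, neg_div, div_self (cos_pi_div_two_mul_pos hm).ne']

lemma abs_chebRef_le (hm : 2 ≤ m) (j : Fin m) : |chebRef m j| ≤ 1 := by
  have hm' : (0 : ℝ) < m := by exact_mod_cast (by omega : 0 < m)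
  have hpi := Real.pi_pos
  have hj : ((j : ℕ) : ℝ) + 1 ≤ m := by exact_mod_cast j.2
  have h0 : (0 : ℝ) ≤ (j : ℕ) := Nat.cast_nonneg _
  have hc := cos_pi_div_two_mul_pos hm
  have hA := chebAngle_mem j
  have h1 : 0 ≤ Real.pi / (2 * m) := by positivity
  rw [chebRef, abs_le, le_div_iff₀ hc, div_le_iff₀ hc, neg_one_mul, one_mul,
    ← Real.cos_pi_sub]
  constructor
  · refine Real.cos_le_cos_of_nonneg_of_le_pi hA.1 (by linarith) ?_
    rw [div_le_iff₀ (by positivity), sub_mul, div_mul_cancel₀ _ (by positivity)]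
    nlinarith
  · refine Real.cos_le_cos_of_nonneg_of_le_pi h1 hA.2 ?_
    gcongr
    nlinarith

lemma chebNode_mem (hm : 2 ≤ m) {a b : ℝ} (hab : a ≤ b) (j : Fin m) :
    chebNode m a b j ∈ Set.Icc a b := by
  have := abs_le.1 (abs_chebRef_le hm j)
  rw [chebNode_eq]
  constructor <;> nlinarith

lemma chebNode_injective (hm : 2 ≤ m) {a b : ℝ} (hab : a < b) :
    Function.Injective (chebNode m a b) := by
  intro i j h
  rw [chebNode_eq, chebNode_eq, add_right_inj, mul_right_inj' (by linarith)] at h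
  exact chebRef_injective hm h

/-- The division by `cos (π / (2m))` turns the endpoints into nodes. The continuity of the splines
rests on this. -/
lemma exists_chebNode_eq (hm : 2 ≤ m) {a b x : ℝ} (hx : x = a ∨ x = b) :
    ∃ j, chebNode m a b j = x := by
  rcases hx with rfl | rfl
  · obtain ⟨j, hj⟩ := exists_chebRef_eq_neg_one hm
    exact ⟨j, by rw [chebNode_eq, hj]; ring⟩
  · obtain ⟨j, hj⟩ := exists_chebRef_eq_one hm
    exact ⟨j, by rw [chebNode_eq, hj]; ring⟩

/-- The Lagrange basis polynomials of the Chebyshev nodes of a cell. -/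
noncomputable def chebBasis (m : ℕ) (I : ℝ × ℝ) (j : Fin m) : Polynomial ℝ :=
  Lagrange.basis Finset.univ (chebNode m I.1 I.2) j

lemma eval_chebBasis_node (hm : 2 ≤ m) {I : ℝ × ℝ} (hI : I.1 < I.2) (i j : Fin m) :
    (chebBasis m I i).eval (chebNode m I.1 I.2 j) = if i = j then 1 else 0 := by
  split_ifs with h
  · rw [h]
    exact Lagrange.eval_basis_self (chebNode_injective hm hI).injOn (Finset.mem_univ _)
  · exact Lagrange.eval_basis_of_ne h (Finset.mem_univ _)

lemma sum_eval_mul_chebBasis (hm : 2 ≤ m) {I : ℝ × ℝ} (hI : I.1 < I.2) {q : Polynomial ℝ}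
    (hq : q.natDegree < m) (t : ℝ) :
    ∑ j, q.eval (chebNode m I.1 I.2 j) * (chebBasis m I j).eval t = q.eval t := by
  have h : q.degree < (Finset.univ : Finset (Fin m)).card := by
    rw [Finset.card_univ, Fintype.card_fin]
    exact Polynomial.degree_le_natDegree.trans_lt (by exact_mod_cast hq)
  conv_rhs => rw [Lagrange.eq_interpolate (chebNode_injective hm hI).injOn h]
  simp [Lagrange.interpolate_apply, Polynomial.eval_finsetSum, chebBasis]

lemma natDegree_chebBasis (hm : 2 ≤ m) {I : ℝ × ℝ} (hI : I.1 < I.2) (j : Fin m) :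
    (chebBasis m I j).natDegree = m - 1 := by
  rw [chebBasis, Lagrange.natDegree_basis (chebNode_injective hm hI).injOn (Finset.mem_univ _)]
  simp

/-- The Lagrange basis is bounded on the cell, uniformly in the cell. -/
lemma exists_bound_chebBasis (hm : 2 ≤ m) : ∃ M : ℝ, 0 < M ∧ ∀ I : ℝ × ℝ, I.1 < I.2 →
    ∀ j, ∀ t ∈ Set.Icc I.1 I.2, |(chebBasis m I j).eval t| ≤ M := by
  -- Each factor of a basis polynomial is `(t - x_i) / (x_j - x_i)`, at most `2 / |chebRef m j -
  -- chebRef m i|` in modulus whatever the cell. `B` dominates all these ratios; the diagonal terms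
  -- are `2 / 0 = 0`, and the summand `1` makes `B` positive.
  set B : ℝ := 1 + ∑ i : Fin m, ∑ j : Fin m, 2 / |chebRef m i - chebRef m j| with hB
  have hterm : ∀ i j : Fin m, 2 / |chebRef m i - chebRef m j| ≤ B := by
    intro i j
    have h1 : 2 / |chebRef m i - chebRef m j| ≤ ∑ j : Fin m, 2 / |chebRef m i - chebRef m j| :=
      Finset.single_le_sum (f := fun j => 2 / |chebRef m i - chebRef m j|)
        (fun j _ => by positivity) (Finset.mem_univ j)
    have h2 := Finset.single_le_sum (f := fun i => ∑ j : Fin m, 2 / |chebRef m i - chebRef m j|)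
        (fun i _ => by positivity) (Finset.mem_univ i)
    linarith
  have hB0 : 0 < B := by positivity
  refine ⟨B ^ (m - 1), by positivity, ?_⟩
  intro I hI j t ht
  rw [chebBasis, Lagrange.basis, Polynomial.eval_prod, Finset.abs_prod]
  refine (Finset.prod_le_prod (g := fun _ => B) (fun i _ => abs_nonneg _) ?_).trans (le_of_eq ?_)
  · intro i hi
    have hij : j ≠ i := (Finset.ne_of_mem_erase hi).symm
    have hne : chebRef m j - chebRef m i ≠ 0 :=
      sub_ne_zero.2 fun h => hij (chebRef_injective hm h)
    refine le_trans ?_ (hterm j i)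
    have hmem := chebNode_mem hm hI.le i
    have habs : |t - chebNode m I.1 I.2 i| ≤ I.2 - I.1 := by
      rw [abs_le]; constructor <;> linarith [ht.1, ht.2, hmem.1, hmem.2]
    have hd : chebNode m I.1 I.2 j - chebNode m I.1 I.2 i =
        (I.2 - I.1) / 2 * (chebRef m j - chebRef m i) := by
      rw [chebNode_eq, chebNode_eq]; ring
    have hpos : 0 < I.2 - I.1 := by linarith
    simp only [Lagrange.basisDivisor, Polynomial.eval_mul, Polynomial.eval_C, Polynomial.eval_sub,
      Polynomial.eval_X]
    rw [hd, abs_mul, abs_inv, abs_mul, abs_of_pos (by linarith : 0 < (I.2 - I.1) / 2)]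
    have h3 := abs_pos.2 hne
    rw [inv_mul_le_iff₀ (by positivity)]
    calc _ ≤ I.2 - I.1 := habs
      _ = _ := by field_simp
  · simp

end chebyshev

/-! ### Tensor interpolation on a box and on a product grid -/

section interp

variable {m l : ℕ}

/-- The tensor product Chebyshev interpolation of `ψ` on the box with edges `I i`. -/
noncomputable def boxInterp (m : ℕ) (I : Fin l → ℝ × ℝ) (ψ : (Fin l → ℝ) → ℝ) (t : Fin l → ℝ) : ℝ :=
  ∑ j : Fin l → Fin m, ψ (fun i => chebNode m (I i).1 (I i).2 (j i)) *
    ∏ i, (chebBasis m (I i) (j i)).eval (t i)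

lemma boxInterp_node (hm : 2 ≤ m) {I : Fin l → ℝ × ℝ} (hI : ∀ i, (I i).1 < (I i).2)
    (ψ : (Fin l → ℝ) → ℝ) (j : Fin l → Fin m) :
    boxInterp m I ψ (fun i => chebNode m (I i).1 (I i).2 (j i)) =
      ψ (fun i => chebNode m (I i).1 (I i).2 (j i)) := by
  rw [boxInterp, Finset.sum_eq_single j]
  · simp [eval_chebBasis_node hm (hI _)]
  · intro k _ hk
    obtain ⟨i, hi⟩ := Function.ne_iff.1 hk
    rw [Finset.prod_eq_zero (Finset.mem_univ i), mul_zero]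
    simp [eval_chebBasis_node hm (hI i), hi]
  · simp

/-- On a monomial the sum over multi-indices factors into one-dimensional interpolations, each of
which reproduces its power. -/
lemma boxInterp_eval (hm : 2 ≤ m) {I : Fin l → ℝ × ℝ} (hI : ∀ i, (I i).1 < (I i).2)
    {p : MvPolynomial (Fin l) ℝ} (hp : p ∈ MvPolynomial.restrictDegree (Fin l) ℝ (m - 1))
    (t : Fin l → ℝ) : boxInterp m I (fun x => MvPolynomial.eval x p) t = MvPolynomial.eval t p := by
  rw [MvPolynomial.mem_restrictDegree] at hp
  simp only [boxInterp, MvPolynomial.eval_eq', Finset.sum_mul]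
  rw [Finset.sum_comm]
  refine Finset.sum_congr rfl fun d hd => ?_
  simp only [mul_assoc, ← Finset.prod_mul_distrib]
  rw [← Finset.mul_sum, ← Fintype.piFinset_univ, ← Finset.prod_univ_sum (fun _ => Finset.univ)
    (fun i k => chebNode m (I i).1 (I i).2 k ^ d i * (chebBasis m (I i) k).eval (t i))]
  congr 1
  refine Finset.prod_congr rfl fun i _ => ?_
  have := sum_eval_mul_chebBasis hm (hI i) (q := Polynomial.X ^ d i)
    (by rw [Polynomial.natDegree_X_pow]; have := hp d hd i; omega) (t i)
  simpa using this

lemma degreeOf_aeval_X_le {σ : Type*} (q : Polynomial ℝ) (i k : σ) :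
    MvPolynomial.degreeOf i (Polynomial.aeval (MvPolynomial.X k : MvPolynomial σ ℝ) q) ≤
      q.natDegree * MvPolynomial.degreeOf i (MvPolynomial.X k : MvPolynomial σ ℝ) := by
  rw [Polynomial.aeval_eq_sum_range]
  refine (MvPolynomial.degreeOf_sum_le _ _ _).trans (Finset.sup_le fun n hn => ?_)
  rw [MvPolynomial.smul_eq_C_mul]
  refine (MvPolynomial.degreeOf_C_mul_le _ _ _).trans
    ((MvPolynomial.degreeOf_pow_le _ _ _).trans (Nat.mul_le_mul_right _ ?_))
  exact Nat.lt_succ_iff.1 (Finset.mem_range.1 hn)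

lemma prod_aeval_X_mem_restrictDegree {q : Fin l → Polynomial ℝ} {d : ℕ}
    (hq : ∀ i, (q i).natDegree ≤ d) :
    ∏ i, Polynomial.aeval (MvPolynomial.X i : MvPolynomial (Fin l) ℝ) (q i) ∈
      MvPolynomial.restrictDegree (Fin l) ℝ d := by
  rw [MvPolynomial.mem_restrictDegree]
  intro e he i
  refine MvPolynomial.degreeOf_le_iff.1 ?_ e he
  refine (MvPolynomial.degreeOf_prod_le _ _ _).trans ?_
  rw [Finset.sum_eq_single i]
  · refine (degreeOf_aeval_X_le _ _ _).trans ?_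
    rw [MvPolynomial.degreeOf_X_self, mul_one]
    exact hq i
  · intro k _ hk
    refine Nat.le_zero.1 ((degreeOf_aeval_X_le _ _ _).trans ?_)
    rw [MvPolynomial.degreeOf_X_of_ne hk.symm, mul_zero]
  · simp

lemma exists_boxInterp_eq_eval (hm : 2 ≤ m) {I : Fin l → ℝ × ℝ} (hI : ∀ i, (I i).1 < (I i).2)
    (ψ : (Fin l → ℝ) → ℝ) : ∃ p ∈ MvPolynomial.restrictDegree (Fin l) ℝ (m - 1),
      ∀ t, boxInterp m I ψ t = MvPolynomial.eval t p := by
  refine ⟨∑ j : Fin l → Fin m, ψ (fun i => chebNode m (I i).1 (I i).2 (j i)) •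
    ∏ i, Polynomial.aeval (MvPolynomial.X i : MvPolynomial (Fin l) ℝ) (chebBasis m (I i) (j i)),
    Submodule.sum_mem _ fun j _ => Submodule.smul_mem _ _
      (prod_aeval_X_mem_restrictDegree fun i => (natDegree_chebBasis hm (hI i) _).le), ?_⟩
  intro t
  have h : ∀ (q : Polynomial ℝ) (i : Fin l),
      MvPolynomial.eval t (Polynomial.aeval (MvPolynomial.X i : MvPolynomial (Fin l) ℝ) q) =
        q.eval (t i) := by
    intro q i
    rw [← MvPolynomial.coe_aeval_eq_eval, RingHom.coe_coe, ← Polynomial.aeval_algHom_apply,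
      MvPolynomial.aeval_X, Polynomial.coe_aeval_eq_eval]
  simp [boxInterp, h]

lemma abs_boxInterp_le {M : ℝ} {I : Fin l → ℝ × ℝ} {t : Fin l → ℝ}
    (hM : ∀ i j, |(chebBasis m (I i) j).eval (t i)| ≤ M) {ψ : (Fin l → ℝ) → ℝ} {ε : ℝ}
    (hψ : ∀ j : Fin l → Fin m, |ψ (fun i => chebNode m (I i).1 (I i).2 (j i))| ≤ ε) :
    |boxInterp m I ψ t| ≤ (m : ℝ) ^ l * M ^ l * ε := by
  refine (Finset.abs_sum_le_sum_abs _ _).trans ?_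
  refine (Finset.sum_le_card_nsmul _ _ (ε * M ^ l) fun j _ => ?_).trans (le_of_eq ?_)
  · have hε := (abs_nonneg _).trans (hψ j)
    rw [abs_mul, Finset.abs_prod]
    refine mul_le_mul (hψ j) ?_ (Finset.prod_nonneg fun i _ => abs_nonneg _) hε
    refine (Finset.prod_le_prod (g := fun _ => M) (fun i _ => abs_nonneg _)
      fun i _ => hM i _).trans (le_of_eq ?_)
    simp
  · simp
    ring

/-- The restriction to a cell of the cardinal function of the node `y`. -/
noncomputable def cellHat (m : ℕ) (I : ℝ × ℝ) (y t : ℝ) : ℝ :=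
  ∑ j, if chebNode m I.1 I.2 j = y then (chebBasis m I j).eval t else 0

lemma continuous_cellHat (m : ℕ) (I : ℝ × ℝ) (y : ℝ) : Continuous (cellHat m I y) := by
  refine continuous_finsetSum _ fun j _ => ?_
  split_ifs
  · exact (chebBasis m I j).continuous
  · exact continuous_const

/-- The value at an endpoint does not involve the cell, so adjacent cells agree there. This makes
`hat` independent of the chosen cell, and continuous. -/
lemma cellHat_endpoint (hm : 2 ≤ m) {I : ℝ × ℝ} (hI : I.1 < I.2) {t : ℝ}
    (ht : t = I.1 ∨ t = I.2) (y : ℝ) : cellHat m I y t = if t = y then 1 else 0 := by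
  obtain ⟨k, rfl⟩ := exists_chebNode_eq hm ht
  rw [cellHat, Finset.sum_eq_single k]
  · simp [eval_chebBasis_node hm hI]
  · intro j _ hj
    simp [eval_chebBasis_node hm hI, hj]
  · simp

open Classical in
/-- The piecewise polynomial cardinal function of the node `y` of the partition `G`. -/
noncomputable def hat (m : ℕ) (G : Finset (ℝ × ℝ)) (y t : ℝ) : ℝ :=
  if h : ∃ I ∈ G, t ∈ Set.Icc I.1 I.2 then cellHat m h.choose y t else 0

/-- The nodes of all cells of `G`. -/
noncomputable def gridNodes (m : ℕ) (G : Finset (ℝ × ℝ)) : Finset ℝ :=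
  G.biUnion fun I => Finset.univ.image (chebNode m I.1 I.2)

/-- The tensor product piecewise interpolation on the product partition `G × ⋯ × G`. -/
noncomputable def gridInterp (m : ℕ) (G : Finset (ℝ × ℝ)) (ψ : (Fin l → ℝ) → ℝ)
    (t : Fin l → ℝ) : ℝ :=
  ∑ x ∈ Fintype.piFinset fun _ : Fin l => gridNodes m G, ψ x * ∏ i, hat m G (x i) (t i)

/-- A finite family of nonoverlapping nondegenerate intervals. -/
structure IsNonoverlapping (G : Finset (ℝ × ℝ)) : Prop where
  lt : ∀ I ∈ G, I.1 < I.2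
  sep : ∀ I ∈ G, ∀ J ∈ G, I ≠ J → I.2 ≤ J.1 ∨ J.2 ≤ I.1

variable {G : Finset (ℝ × ℝ)}

lemma hat_eq_cellHat (hm : 2 ≤ m) (hG : IsNonoverlapping G) {I : ℝ × ℝ} (hI : I ∈ G) {t : ℝ}
    (ht : t ∈ Set.Icc I.1 I.2) (y : ℝ) : hat m G y t = cellHat m I y t := by
  have h : ∃ I ∈ G, t ∈ Set.Icc I.1 I.2 := ⟨I, hI, ht⟩
  rw [hat, dif_pos h]
  have hJ := h.choose_spec
  set J := h.choose
  by_cases hIJ : I = J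
  · rw [hIJ]
  · rcases hG.sep I hI J hJ.1 hIJ with h1 | h1
    · rw [cellHat_endpoint hm (hG.lt J hJ.1) (Or.inl (by linarith [ht.2, hJ.2.1])),
        cellHat_endpoint hm (hG.lt I hI) (Or.inr (by linarith [ht.2, hJ.2.1]))]
    · rw [cellHat_endpoint hm (hG.lt J hJ.1) (Or.inr (by linarith [ht.1, hJ.2.2])),
        cellHat_endpoint hm (hG.lt I hI) (Or.inl (by linarith [ht.1, hJ.2.2]))]

lemma continuousOn_hat (hm : 2 ≤ m) (hG : IsNonoverlapping G) (y : ℝ) :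
    ContinuousOn (hat m G y) (⋃ I ∈ G, Set.Icc I.1 I.2) := by
  have := (locallyFinite_of_finite fun I : G => Set.Icc I.1.1 I.1.2).continuousOn_iUnion
    (g := hat m G y) (fun _ => isClosed_Icc) fun I =>
      (continuous_cellHat m I.1 y).continuousOn.congr fun t ht => hat_eq_cellHat hm hG I.2 ht y
  rwa [Set.iUnion_subtype] at this

lemma continuousOn_gridInterp (hm : 2 ≤ m) (hG : IsNonoverlapping G) (ψ : (Fin l → ℝ) → ℝ) :
    ContinuousOn (gridInterp m G ψ) {t | ∀ i, t i ∈ ⋃ I ∈ G, Set.Icc I.1 I.2} := by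
  refine continuousOn_finsetSum _ fun x _ => continuousOn_const.mul ?_
  refine continuousOn_finsetProd _ fun i _ => ?_
  exact (continuousOn_hat hm hG (x i)).comp (continuous_apply i).continuousOn fun t ht => ht i

/-- On the box, the product of the functions `hat` at a grid node `x` expands into the terms of
those multi-indices whose node is `x`. Nodes outside the box contribute nothing. -/
lemma gridInterp_eq_boxInterp (hm : 2 ≤ m) (hG : IsNonoverlapping G) {I : Fin l → ℝ × ℝ}
    (hI : ∀ i, I i ∈ G) {t : Fin l → ℝ} (ht : ∀ i, t i ∈ Set.Icc (I i).1 (I i).2)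
    (ψ : (Fin l → ℝ) → ℝ) : gridInterp m G ψ t = boxInterp m I ψ t := by
  have h1 : ∀ x : Fin l → ℝ, ∏ i, hat m G (x i) (t i) =
      ∑ j : Fin l → Fin m, if (fun i => chebNode m (I i).1 (I i).2 (j i)) = x then
        ∏ i, (chebBasis m (I i) (j i)).eval (t i) else 0 := by
    intro x
    simp only [hat_eq_cellHat hm hG (hI _) (ht _), cellHat]
    rw [Finset.prod_univ_sum, Fintype.piFinset_univ]
    refine Finset.sum_congr rfl fun j _ => ?_
    rw [Finset.prod_ite_zero]
    simp [funext_iff]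
  simp only [gridInterp, h1, Finset.mul_sum, mul_ite, mul_zero]
  rw [Finset.sum_comm]
  refine Finset.sum_congr rfl fun j _ => ?_
  rw [Finset.sum_ite_eq, if_pos]
  rw [Fintype.mem_piFinset]
  exact fun i => Finset.mem_biUnion.2 ⟨I i, hI i, Finset.mem_image_of_mem _ (Finset.mem_univ _)⟩

lemma gridInterp_add (ψ χ : (Fin l → ℝ) → ℝ) :
    gridInterp m G (ψ + χ) = gridInterp m G ψ + gridInterp m G χ := by
  ext t
  simp [gridInterp, add_mul, Finset.sum_add_distrib]

lemma gridInterp_smul (c : ℝ) (ψ : (Fin l → ℝ) → ℝ) :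
    gridInterp m G (c • ψ) = c • gridInterp m G ψ := by
  ext t
  simp [gridInterp, Finset.mul_sum, mul_assoc]

lemma boxInterp_sub (I : Fin l → ℝ × ℝ) (ψ χ : (Fin l → ℝ) → ℝ) (t : Fin l → ℝ) :
    boxInterp m I (fun x => ψ x - χ x) t = boxInterp m I ψ t - boxInterp m I χ t := by
  simp [boxInterp, sub_mul, Finset.sum_sub_distrib]

end interp

/-! ### The spline, its continuity and its stability -/

section spline

variable {m l : ℕ} {η : ℕ → ℝ}

/-- The spline on the `j + 1` innermost layers, constructed from the centre outwards: the values
already constructed are interpolated on the inner cube and `f` is interpolated elsewhere. -/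
noncomputable def spline (m : ℕ) (η : ℕ → ℝ) : ℕ → ((Fin l → ℝ) → ℝ) → (Fin l → ℝ) → ℝ
  | 0, f => gridInterp m (gridCells η 0) f
  | j + 1, f => gridInterp m (gridCells η (j + 1)) fun x =>
      if ‖x‖ ≤ radius η (j + 1) then spline m η j f x else f x

/-- A product of cells of level `j` which lies in the layer of level `j`. -/
def IsShellBox (η : ℕ → ℝ) (j : ℕ) (I : Fin l → ℝ × ℝ) : Prop :=
  (∀ i, I i ∈ gridCells η j) ∧ ∃ i, I i ∈ endCells η j

lemma spline_add (j : ℕ) (f g : (Fin l → ℝ) → ℝ) :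
    spline m η j (f + g) = spline m η j f + spline m η j g := by
  induction j with
  | zero => exact gridInterp_add f g
  | succ j ih =>
    rw [spline, ih, spline, spline, ← gridInterp_add]
    congr 1
    ext x
    simp only [Pi.add_apply]
    split_ifs <;> rfl

lemma spline_smul (j : ℕ) (c : ℝ) (f : (Fin l → ℝ) → ℝ) :
    spline m η j (c • f) = c • spline m η j f := by
  induction j with
  | zero => exact gridInterp_smul c f
  | succ j ih =>
    rw [spline, ih, spline, ← gridInterp_smul]
    congr 1
    ext x
    simp only [Pi.smul_apply]
    split_ifs <;> rfl

/-- This treats the centre and the other levels alike: the interpolated data can differ from `f`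
only on the closed inner cube, and at level `0` nowhere. -/
lemma exists_spline_eq_gridInterp (j : ℕ) (f : (Fin l → ℝ) → ℝ) :
    ∃ ψ : (Fin l → ℝ) → ℝ, spline m η j f = gridInterp m (gridCells η j) ψ ∧
      ∀ x, (j ≠ 0 → radius η j < ‖x‖) → ψ x = f x := by
  cases j with
  | zero => exact ⟨f, rfl, fun _ _ => rfl⟩
  | succ j => exact ⟨_, rfl, fun x hx => if_neg (not_le.2 (hx j.succ_ne_zero))⟩

lemma isNonoverlapping_gridCells (hη : ∀ j, 0 < η j) (hanti : Antitone η) (j : ℕ) :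
    IsNonoverlapping (gridCells η j) :=
  ⟨fun _ hI => gridCells_lt hη hanti hI, gridCells_separated hη hanti j⟩

lemma norm_le_radius_of_mem (hη : ∀ j, 0 < η j) (hanti : Antitone η) {j : ℕ}
    {I : Fin l → ℝ × ℝ} (hI : ∀ i, I i ∈ gridCells η j) {t : Fin l → ℝ}
    (ht : ∀ i, t i ∈ Set.Icc (I i).1 (I i).2) : ‖t‖ ≤ radius η (j + 1) :=
  (pi_norm_le_iff_of_nonneg (radius_nonneg hη _)).2 fun i =>
    abs_le_of_mem_gridCells hη hanti (hI i) (ht i)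

lemma IsShellBox.radius_le_norm {j : ℕ} {I : Fin l → ℝ × ℝ}
    (hI : IsShellBox η j I) {t : Fin l → ℝ} (ht : ∀ i, t i ∈ Set.Icc (I i).1 (I i).2) :
    radius η j ≤ ‖t‖ := by
  obtain ⟨i, hi⟩ := hI.2
  exact (le_abs_of_mem_endCells hi (ht i)).trans (norm_le_pi_norm t i)

lemma exists_abs_eq_norm (hl : 0 < l) (t : Fin l → ℝ) : ∃ i, |t i| = ‖t‖ := by
  have : Nonempty (Fin l) := ⟨⟨0, hl⟩⟩
  obtain ⟨i, hi⟩ := Finite.exists_max fun i => ‖t i‖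
  exact ⟨i, le_antisymm (norm_le_pi_norm t i) ((pi_norm_le_iff_of_nonempty t).2 hi)⟩

lemma exists_gridBox (hη : ∀ j, 0 < η j) (hanti : Antitone η) {j : ℕ} {t : Fin l → ℝ}
    (ht : ‖t‖ ≤ radius η (j + 1)) :
    ∃ I : Fin l → ℝ × ℝ, (∀ i, I i ∈ gridCells η j) ∧ ∀ i, t i ∈ Set.Icc (I i).1 (I i).2 := by
  choose I hI htI using fun i =>
    exists_mem_gridCells hη hanti j (t i) ((norm_le_pi_norm t i).trans ht)
  exact ⟨I, hI, htI⟩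

/-- In a coordinate of maximal modulus the cell is exchanged for an end cell. The exchange matters
on the inner surface, where that coordinate also belongs to a cell which is not an end cell. -/
lemma exists_shellBox (hl : 0 < l) (hη : ∀ j, 0 < η j) (hanti : Antitone η) {j : ℕ}
    {t : Fin l → ℝ} (h1 : radius η j ≤ ‖t‖) (h2 : ‖t‖ ≤ radius η (j + 1)) :
    ∃ I : Fin l → ℝ × ℝ, IsShellBox η j I ∧ ∀ i, t i ∈ Set.Icc (I i).1 (I i).2 := by
  obtain ⟨I, hI, htI⟩ := exists_gridBox hη hanti h2
  obtain ⟨i, hi⟩ := exists_abs_eq_norm hl t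
  obtain ⟨J, hJ, htJ⟩ := exists_mem_endCells (hi ▸ h1) (hi ▸ h2)
  refine ⟨Function.update I i J, ⟨fun k => ?_, i, by simpa using hJ⟩, fun k => ?_⟩
  · rcases eq_or_ne k i with rfl | hk
    · simpa using endCells_subset_gridCells j hJ
    · simpa [hk] using hI k
  · rcases eq_or_ne k i with rfl | hk
    · simpa using htJ
    · simpa [hk] using htI k

lemma exists_spline_eq_eval (hm : 2 ≤ m) (hη : ∀ j, 0 < η j) (hanti : Antitone η) (j : ℕ)
    (f : (Fin l → ℝ) → ℝ) {I : Fin l → ℝ × ℝ} (hI : ∀ i, I i ∈ gridCells η j) :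
    ∃ p ∈ MvPolynomial.restrictDegree (Fin l) ℝ (m - 1),
      ∀ t : Fin l → ℝ, (∀ i, t i ∈ Set.Icc (I i).1 (I i).2) →
        spline m η j f t = MvPolynomial.eval t p := by
  obtain ⟨ψ, hψ, -⟩ := exists_spline_eq_gridInterp (m := m) (η := η) j f
  have hG := isNonoverlapping_gridCells hη hanti j
  obtain ⟨p, hp, h⟩ := exists_boxInterp_eq_eval hm (fun i => hG.lt _ (hI i)) ψ
  exact ⟨p, hp, fun t ht => by rw [hψ, gridInterp_eq_boxInterp hm hG hI ht, h]⟩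

/-- A fine box inside the inner cube lies in one coarse box, on which the old spline is a polynomial
of admissible degree; interpolation reproduces that polynomial. -/
lemma spline_succ_of_norm_le (hm : 2 ≤ m) (hη : ∀ j, 0 < η j) (hanti : Antitone η) {j : ℕ}
    (f : (Fin l → ℝ) → ℝ) {t : Fin l → ℝ} (ht : ‖t‖ ≤ radius η (j + 1)) :
    spline m η (j + 1) f t = spline m η j f t := by
  obtain ⟨J, hJ, htJ⟩ := exists_gridBox hη hanti ht
  choose I hI htI using fun i =>
    exists_mem_subdivide (hη (j + 1)) (le_length_of_mem_gridCells hη hanti (hJ i)) (htJ i)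
  have hIJ := fun i =>
    subdivide_subset (hη (j + 1)) (le_length_of_mem_gridCells hη hanti (hJ i)) (hI i)
  have hI' : ∀ i, I i ∈ gridCells η (j + 1) := fun i =>
    mem_gridCells_succ.2 (Or.inr ⟨J i, hJ i, hI i⟩)
  obtain ⟨p, hp, h⟩ := exists_spline_eq_eval hm hη hanti j f hJ
  have hG := isNonoverlapping_gridCells hη hanti (j + 1)
  rw [spline, gridInterp_eq_boxInterp hm hG hI' htI, h t htJ,
    ← boxInterp_eval hm (fun i => hG.lt _ (hI' i)) hp]
  refine Finset.sum_congr rfl fun k _ => ?_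
  -- All nodes of the fine box lie in the coarse box, so the data there are values of `p`.
  have hmem : ∀ i, chebNode m (I i).1 (I i).2 (k i) ∈ Set.Icc (J i).1 (J i).2 := fun i =>
    Set.Icc_subset_Icc (hIJ i).1 (hIJ i).2 (chebNode_mem hm (hG.lt _ (hI' i)).le _)
  beta_reduce
  rw [if_pos (norm_le_radius_of_mem hη hanti hJ hmem), h _ hmem]

lemma spline_of_norm_le (hm : 2 ≤ m) (hη : ∀ j, 0 < η j) (hanti : Antitone η) {j k : ℕ}
    (hjk : j ≤ k) (f : (Fin l → ℝ) → ℝ) {t : Fin l → ℝ} (ht : ‖t‖ ≤ radius η (j + 1)) :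
    spline m η k f t = spline m η j f t := by
  induction k, hjk using Nat.le_induction with
  | base => rfl
  | succ k hjk ih =>
    rw [spline_succ_of_norm_le hm hη hanti f
      (ht.trans ((radius_strictMono hη).monotone (by omega))), ih]

lemma spline_node (hm : 2 ≤ m) (hη : ∀ j, 0 < η j) (hanti : Antitone η) {j : ℕ}
    (f : (Fin l → ℝ) → ℝ) {I : Fin l → ℝ × ℝ} (hI : ∀ i, I i ∈ gridCells η j)
    (k : Fin l → Fin m)
    (hk : j ≠ 0 → radius η j < ‖fun i => chebNode m (I i).1 (I i).2 (k i)‖) :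
    spline m η j f (fun i => chebNode m (I i).1 (I i).2 (k i)) =
      f fun i => chebNode m (I i).1 (I i).2 (k i) := by
  obtain ⟨ψ, hψ, hψf⟩ := exists_spline_eq_gridInterp (m := m) (η := η) j f
  have hG := isNonoverlapping_gridCells hη hanti j
  rw [hψ, gridInterp_eq_boxInterp hm hG hI fun i => chebNode_mem hm (hG.lt _ (hI i)).le _,
    boxInterp_node hm (fun i => hG.lt _ (hI i)), hψf _ hk]

lemma continuousOn_spline (hm : 2 ≤ m) (hη : ∀ j, 0 < η j) (hanti : Antitone η) (j : ℕ)
    (f : (Fin l → ℝ) → ℝ) :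
    ContinuousOn (spline m η j f) {t | ‖t‖ ≤ radius η (j + 1)} := by
  obtain ⟨ψ, hψ, -⟩ := exists_spline_eq_gridInterp (m := m) (η := η) j f
  rw [hψ]
  refine (continuousOn_gridInterp hm (isNonoverlapping_gridCells hη hanti j) ψ).mono
    fun t ht i => ?_
  obtain ⟨I, hI, htI⟩ := exists_mem_gridCells hη hanti j (t i) ((norm_le_pi_norm t i).trans ht)
  exact Set.mem_iUnion₂.2 ⟨I, hI, htI⟩

/-- The spline is determined by the values at the nodes of the boxes of the layers. -/
lemma spline_eq_zero (hl : 0 < l) (hm : 2 ≤ m) (hη : ∀ j, 0 < η j) (hanti : Antitone η)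
    {f : (Fin l → ℝ) → ℝ} {j : ℕ}
    (hf : ∀ k ≤ j, ∀ I : Fin l → ℝ × ℝ, IsShellBox η k I → ∀ n : Fin l → Fin m,
      f (fun i => chebNode m (I i).1 (I i).2 (n i)) = 0) :
    ∀ t : Fin l → ℝ, ‖t‖ ≤ radius η (j + 1) → spline m η j f t = 0 := by
  induction j with
  | zero =>
    intro t ht
    obtain ⟨I, hI, htI⟩ := exists_shellBox hl hη hanti (radius_zero (η := η) ▸ norm_nonneg t) ht
    rw [spline, gridInterp_eq_boxInterp hm (isNonoverlapping_gridCells hη hanti 0) hI.1 htI]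
    exact Finset.sum_eq_zero fun n _ => by rw [hf 0 le_rfl I hI, zero_mul]
  | succ j ih =>
    intro t ht
    have ih := ih fun k hk => hf k (by omega)
    rcases le_total ‖t‖ (radius η (j + 1)) with h | h
    · rw [spline_succ_of_norm_le hm hη hanti f h, ih t h]
    · obtain ⟨I, hI, htI⟩ := exists_shellBox hl hη hanti h ht
      rw [spline, gridInterp_eq_boxInterp hm (isNonoverlapping_gridCells hη hanti _) hI.1 htI]
      refine Finset.sum_eq_zero fun n _ => ?_
      beta_reduce
      split_ifs with hn
      · rw [ih _ hn, zero_mul]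
      · rw [hf _ le_rfl I hI, zero_mul]

/-- On the outer surface of its domain the spline interpolates `f` alone. -/
lemma spline_eq_boxInterp_of_norm_eq (hl : 0 < l) (hm : 2 ≤ m) (hη : ∀ j, 0 < η j)
    (hanti : Antitone η) {j : ℕ} (f : (Fin l → ℝ) → ℝ) {I : Fin l → ℝ × ℝ}
    (hI : ∀ i, I i ∈ gridCells η j) {t : Fin l → ℝ} (ht : ∀ i, t i ∈ Set.Icc (I i).1 (I i).2)
    (htn : ‖t‖ = radius η (j + 1)) : spline m η j f t = boxInterp m I f t := by
  obtain ⟨ψ, hψ, hψf⟩ := exists_spline_eq_gridInterp (m := m) (η := η) j f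
  have hG := isNonoverlapping_gridCells hη hanti j
  rw [hψ, gridInterp_eq_boxInterp hm hG hI ht]
  refine Finset.sum_congr rfl fun n _ => ?_
  -- A coordinate of `t` with modulus `radius η (j + 1)` is an endpoint of its cell, hence a node.
  -- Only nodes sharing this coordinate contribute; they lie on the outer surface, outside the inner
  -- cube, where the data are `f`.
  obtain ⟨i, hi⟩ := exists_abs_eq_norm hl t
  rw [htn] at hi
  have hb := gridCells_bounds hη hanti j (I i) (hI i)
  have hend : t i = (I i).1 ∨ t i = (I i).2 := by
    rcases eq_or_eq_neg_of_abs_eq hi with h | h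
    · right; linarith [(ht i).2]
    · left; linarith [(ht i).1]
  obtain ⟨k, hk⟩ := exists_chebNode_eq hm hend
  by_cases hnk : n i = k
  · rw [hψf]
    intro _
    have := norm_le_pi_norm (fun i => chebNode m (I i).1 (I i).2 (n i)) i
    rw [hnk, hk, Real.norm_eq_abs, hi] at this
    exact (radius_strictMono hη j.lt_succ_self).trans_le this
  · rw [Finset.prod_eq_zero (Finset.mem_univ i), mul_zero, mul_zero]
    rw [← hk, eval_chebBasis_node hm (hG.lt _ (hI i)), if_neg hnk]

/-- Interpolation reproduces `p` and has norm at most `m^l M^l`, so it is applied to `f - p`. -/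
lemma abs_sub_boxInterp_le (hm : 2 ≤ m) {M : ℝ}
    (hM : ∀ I : ℝ × ℝ, I.1 < I.2 → ∀ j, ∀ t ∈ Set.Icc I.1 I.2, |(chebBasis m I j).eval t| ≤ M)
    {I : Fin l → ℝ × ℝ} (hI : ∀ i, (I i).1 < (I i).2) {f : (Fin l → ℝ) → ℝ} {ε : ℝ}
    {p : MvPolynomial (Fin l) ℝ} (hp : p ∈ MvPolynomial.restrictDegree (Fin l) ℝ (m - 1))
    (hf : ∀ t : Fin l → ℝ, (∀ i, t i ∈ Set.Icc (I i).1 (I i).2) →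
      |f t - MvPolynomial.eval t p| ≤ ε)
    {t : Fin l → ℝ} (ht : ∀ i, t i ∈ Set.Icc (I i).1 (I i).2) :
    |f t - boxInterp m I f t| ≤ (1 + (m : ℝ) ^ l * M ^ l) * ε := by
  have h1 : f t - boxInterp m I f t = (f t - MvPolynomial.eval t p) -
      boxInterp m I (fun x => f x - MvPolynomial.eval x p) t := by
    rw [boxInterp_sub, boxInterp_eval hm hI hp]
    ring
  have h2 := abs_boxInterp_le (m := m) (ψ := fun x => f x - MvPolynomial.eval x p)
    (fun i j => hM (I i) (hI i) j (t i) (ht i)) fun j =>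
      hf _ fun i => chebNode_mem hm (hI i).le _
  have h3 := hf t ht
  rw [h1]
  refine (abs_sub _ _).trans ?_
  linarith

/-- The error of the spline in terms of the error of the local polynomial approximation. -/
lemma abs_sub_spline_le (hl : 0 < l) (hm : 2 ≤ m) (hη : ∀ j, 0 < η j) (hanti : Antitone η)
    {M : ℝ} (hM0 : 0 ≤ M)
    (hM : ∀ I : ℝ × ℝ, I.1 < I.2 → ∀ j, ∀ t ∈ Set.Icc I.1 I.2, |(chebBasis m I j).eval t| ≤ M)
    {f : (Fin l → ℝ) → ℝ} {ε : ℝ} (hε : 0 ≤ ε) {j : ℕ}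
    (hf : ∀ k ≤ j, ∀ I : Fin l → ℝ × ℝ, IsShellBox η k I →
      ∃ p ∈ MvPolynomial.restrictDegree (Fin l) ℝ (m - 1), ∀ t : Fin l → ℝ,
        (∀ i, t i ∈ Set.Icc (I i).1 (I i).2) → |f t - MvPolynomial.eval t p| ≤ ε)
    {t : Fin l → ℝ} (h1 : radius η j ≤ ‖t‖) (h2 : ‖t‖ ≤ radius η (j + 1)) :
    |f t - spline m η j f t| ≤ (1 + (m : ℝ) ^ l * M ^ l) ^ 2 * ε := by
  have hG := fun k => isNonoverlapping_gridCells hη hanti k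
  have hL : 0 ≤ (m : ℝ) ^ l * M ^ l := by positivity
  set L := (m : ℝ) ^ l * M ^ l
  have hloc : ∀ k ≤ j, ∀ I : Fin l → ℝ × ℝ, IsShellBox η k I → ∀ t : Fin l → ℝ,
      (∀ i, t i ∈ Set.Icc (I i).1 (I i).2) → |f t - boxInterp m I f t| ≤ (1 + L) * ε := by
    intro k hk I hI t ht
    obtain ⟨p, hp, hpf⟩ := hf k hk I hI
    exact abs_sub_boxInterp_le hm hM (fun i => (hG k).lt _ (hI.1 i)) hp hpf ht
  obtain ⟨I, hI, htI⟩ := exists_shellBox hl hη hanti h1 h2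
  have hmain := hloc j le_rfl I hI t htI
  have hLε : 0 ≤ L * ε := mul_nonneg hL hε
  cases j with
  | zero =>
    rw [spline, gridInterp_eq_boxInterp hm (hG 0) hI.1 htI]
    refine hmain.trans ?_
    nlinarith
  | succ j =>
    rw [spline, gridInterp_eq_boxInterp hm (hG _) hI.1 htI]
    set ψ : (Fin l → ℝ) → ℝ := fun x => if ‖x‖ ≤ radius η (j + 1) then spline m η j f x else f x
    -- The second term sees only the nodes on the inner surface. There `ψ` is the spline of level
    -- `j`, which on this surface is plain interpolation of `f`, so its error is again at most `(1 +
    -- L) ε`. The total is `(1 + L) ε + L (1 + L) ε = (1 + L)^2 ε`, whatever the level.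
    have h3 : f t - boxInterp m I ψ t =
        (f t - boxInterp m I f t) + boxInterp m I (fun x => f x - ψ x) t := by
      rw [boxInterp_sub]
      ring
    have h4 := abs_boxInterp_le (m := m) (ψ := fun x => f x - ψ x) (ε := (1 + L) * ε)
      (fun i k => hM (I i) ((hG _).lt _ (hI.1 i)) k (t i) (htI i)) fun n => by
        have hn := hI.radius_le_norm fun i =>
          chebNode_mem hm ((hG _).lt _ (hI.1 i)).le (n i)
        by_cases h : ‖fun i => chebNode m (I i).1 (I i).2 (n i)‖ ≤ radius η (j + 1)
        · have heq := le_antisymm h hn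
          obtain ⟨J, hJ, htJ⟩ := exists_shellBox hl hη hanti
            (heq ▸ (radius_strictMono hη).monotone j.le_succ) heq.le
          simp only [ψ]
          rw [if_pos h, spline_eq_boxInterp_of_norm_eq hl hm hη hanti f hJ.1 htJ heq]
          exact hloc j j.le_succ J hJ _ htJ
        · simp only [ψ]
          rw [if_neg h, sub_self, abs_zero]
          positivity
    rw [h3]
    refine (abs_add_le _ _).trans ?_
    nlinarith

end spline

/-! ### The cube as the unit ball -/

section cube

variable {l : ℕ}

lemma cube_eq_closedBall : cube l = Metric.closedBall 0 1 := by
  ext t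
  rw [mem_closedBall_zero_iff, pi_norm_le_iff_of_nonneg zero_le_one]
  simp [cube, Set.mem_Icc, Pi.le_def, abs_le, forall_and]

lemma interior_cube : interior (cube l) = Metric.ball 0 1 := by
  rw [cube_eq_closedBall, interior_closedBall _ one_ne_zero]

lemma mem_cube_iff {t : Fin l → ℝ} : t ∈ cube l ↔ ‖t‖ ≤ 1 := by
  rw [cube_eq_closedBall, mem_closedBall_zero_iff]

lemma bdist_eq (hl : 0 < l) {t : Fin l → ℝ} (ht : ‖t‖ ≤ 1) : bdist t = 1 - ‖t‖ := by
  have : Nonempty (Fin l) := ⟨⟨0, hl⟩⟩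
  rw [bdist, cube_eq_closedBall, frontier_closedBall _ one_ne_zero]
  -- The radial projection `e` of `t` is a nearest boundary point; for `t = 0` any unit vector
  -- serves.
  obtain ⟨e, he, hte⟩ : ∃ e : Fin l → ℝ, ‖e‖ = 1 ∧ t = ‖t‖ • e := by
    by_cases h : t = 0
    · obtain ⟨e, he⟩ := exists_norm_eq (Fin l → ℝ) zero_le_one
      exact ⟨e, he, by simp [h]⟩
    · exact ⟨‖t‖⁻¹ • t, norm_smul_inv_norm h, by
        rw [smul_smul, mul_inv_cancel₀ (norm_ne_zero_iff.2 h), one_smul]⟩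
  have hes : e ∈ Metric.sphere (0 : Fin l → ℝ) 1 := by simpa using he
  refine le_antisymm ?_ ((Metric.le_infDist ⟨e, hes⟩).2 fun y hy => ?_)
  · refine (Metric.infDist_le_dist_of_mem hes).trans (le_of_eq ?_)
    have : t - e = (‖t‖ - 1) • e := by rw [sub_smul, one_smul, ← hte]
    rw [dist_eq_norm, this, norm_smul, he, mul_one, Real.norm_eq_abs, abs_of_nonpos (by linarith)]
    ring
  · have hy' : ‖y‖ = 1 := by simpa using hy
    rw [dist_comm, dist_eq_norm, ← hy']
    exact norm_sub_norm_le y t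

end cube

/-! ### Taylor's formula in several variables -/

section taylor

/-- The derivative of the sum telescopes. -/
lemma hasDerivAt_taylor_sum {F : ℕ → ℝ → ℝ} {τ : ℝ} (n : ℕ)
    (hF : ∀ k ≤ n, HasDerivAt (F k) (F (k + 1) τ) τ) :
    HasDerivAt (fun τ => ∑ k ∈ Finset.range (n + 1), (1 - τ) ^ k / k.factorial * F k τ)
      ((1 - τ) ^ n / n.factorial * F (n + 1) τ) τ := by
  induction n with
  | zero => simpa using hF 0 le_rfl
  | succ n ih =>
    have h1 := ih fun k hk => hF k (by omega)
    have h2 : HasDerivAt (fun τ : ℝ => (1 - τ) ^ (n + 1) / (n + 1).factorial)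
        (-((1 - τ) ^ n / n.factorial)) τ := by
      have h := ((((hasDerivAt_id τ).const_sub 1).pow (n + 1)).div_const
        ((n + 1).factorial : ℝ))
      refine h.congr_deriv ?_
      rw [Nat.factorial_succ]
      have : ((n.factorial : ℕ) : ℝ) ≠ 0 := by exact_mod_cast n.factorial_ne_zero
      push_cast
      simp only [id]
      field_simp
    simp only [Finset.sum_range_succ _ (n + 1)]
    exact (h1.add (h2.mul (hF (n + 1) le_rfl))).congr_deriv (by ring)

/-- Taylor's formula with the remainder in Cauchy's form. -/
lemma exists_taylor_cauchy {F : ℕ → ℝ → ℝ} (n : ℕ)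
    (hF : ∀ k ≤ n, ∀ τ ∈ Set.Icc (0 : ℝ) 1, HasDerivAt (F k) (F (k + 1) τ) τ) :
    ∃ ξ ∈ Set.Ioo (0 : ℝ) 1, F 0 1 - ∑ k ∈ Finset.range (n + 1), (1 / k.factorial : ℝ) * F k 0 =
      (1 - ξ) ^ n / n.factorial * F (n + 1) ξ := by
  -- The mean value theorem for the Taylor sum needs only the existence of the last derivative,
  -- whose continuity is not part of the class.
  have hG := fun τ hτ => hasDerivAt_taylor_sum n fun k hk => hF k hk τ hτ
  obtain ⟨ξ, hξ, h⟩ := exists_hasDerivAt_eq_slope _ _ zero_lt_one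
    (fun τ hτ => (hG τ hτ).continuousAt.continuousWithinAt)
    (fun τ hτ => hG τ (Set.Ioo_subset_Icc_self hτ))
  refine ⟨ξ, hξ, h.trans ?_ |>.symm⟩
  rw [Finset.sum_range_succ' _ n]
  simp

variable {l : ℕ}

/-- The class controls partial derivatives only, so directional derivatives are expanded in the
coordinate directions. -/
lemma multilinear_apply_eq_sum {k : ℕ}
    (A : ContinuousMultilinearMap ℝ (fun _ : Fin k => Fin l → ℝ) ℝ) (w : Fin l → ℝ) :
    A (fun _ => w) = ∑ i : Fin k → Fin l, (∏ j, w (i j)) * A (coordDirs i) := by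
  have hw : w = ∑ i, w i • (Pi.single i 1 : Fin l → ℝ) := by
    simp only [← Pi.single_smul, smul_eq_mul, mul_one]
    exact (Finset.univ_sum_single w).symm
  conv_lhs => rw [hw]
  rw [A.map_sum]
  refine Finset.sum_congr rfl fun i _ => ?_
  rw [A.map_smul_univ, smul_eq_mul]
  rfl

lemma abs_multilinear_apply_le {k : ℕ}
    (A : ContinuousMultilinearMap ℝ (fun _ : Fin k => Fin l → ℝ) ℝ) {w : Fin l → ℝ} {B h : ℝ}
    (hA : ∀ i, |A (coordDirs i)| ≤ B) (hw : ‖w‖ ≤ h) :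
    |A (fun _ => w)| ≤ (l : ℝ) ^ k * h ^ k * B := by
  rw [multilinear_apply_eq_sum]
  refine (Finset.abs_sum_le_sum_abs _ _).trans ?_
  refine (Finset.sum_le_card_nsmul _ _ (h ^ k * B) fun i _ => ?_).trans (le_of_eq ?_)
  · rw [abs_mul, Finset.abs_prod]
    refine mul_le_mul ?_ (hA i) (abs_nonneg _) (pow_nonneg ((norm_nonneg w).trans hw) _)
    refine (Finset.prod_le_prod (g := fun _ => h) (fun j _ => abs_nonneg _)
      fun j _ => (norm_le_pi_norm w (i j)).trans hw).trans (le_of_eq ?_)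
    simp
  · simp
    ring

/-- The Taylor polynomial of `f` at `x₀`, of total degree less than `s`. -/
noncomputable def taylorPoly (f : (Fin l → ℝ) → ℝ) (s : ℕ) (x₀ : Fin l → ℝ) :
    MvPolynomial (Fin l) ℝ :=
  ∑ k ∈ Finset.range s, (1 / k.factorial : ℝ) • ∑ i : Fin k → Fin l,
    (iteratedFDeriv ℝ k f x₀ (coordDirs i)) •
      ∏ j, (MvPolynomial.X (i j) - MvPolynomial.C (x₀ (i j)))

lemma taylorPoly_mem (f : (Fin l → ℝ) → ℝ) (s : ℕ) (x₀ : Fin l → ℝ) :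
    taylorPoly f s x₀ ∈ MvPolynomial.restrictDegree (Fin l) ℝ (s - 1) := by
  refine Submodule.sum_mem _ fun k hk => Submodule.smul_mem _ _ (Submodule.sum_mem _ fun i _ =>
    Submodule.smul_mem _ _ (MvPolynomial.restrictTotalDegree_le_restrictDegree _ _ _ ?_))
  rw [MvPolynomial.mem_restrictTotalDegree]
  refine (MvPolynomial.totalDegree_finsetProd _ _).trans ?_
  refine (Finset.sum_le_card_nsmul _ _ 1 fun j _ => ?_).trans ?_
  · refine (MvPolynomial.totalDegree_sub_C_le _ _).trans ?_
    simp
  · have := Finset.mem_range.1 hk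
    simp
    omega

lemma eval_taylorPoly (f : (Fin l → ℝ) → ℝ) (s : ℕ) (x₀ y : Fin l → ℝ) :
    MvPolynomial.eval y (taylorPoly f s x₀) = ∑ k ∈ Finset.range s, (1 / k.factorial : ℝ) *
      iteratedFDeriv ℝ k f x₀ (fun _ => y - x₀) := by
  simp only [multilinear_apply_eq_sum]
  simp [taylorPoly, mul_comm]

lemma hasDerivAt_iteratedFDeriv_line {f : (Fin l → ℝ) → ℝ} {k : ℕ} {x₀ w : Fin l → ℝ} {τ : ℝ}
    (hf : DifferentiableAt ℝ (iteratedFDeriv ℝ k f) (x₀ + τ • w)) :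
    HasDerivAt (fun τ : ℝ => iteratedFDeriv ℝ k f (x₀ + τ • w) fun _ => w)
      (iteratedFDeriv ℝ (k + 1) f (x₀ + τ • w) fun _ => w) τ := by
  have h1 : HasDerivAt (fun τ : ℝ => x₀ + τ • w) w τ := by
    simpa using ((hasDerivAt_id τ).smul_const w).const_add x₀
  have h2 := hf.hasFDerivAt.comp_hasDerivAt τ h1
  have h3 := (ContinuousMultilinearMap.apply ℝ (fun _ : Fin k => Fin l → ℝ) ℝ
    (fun _ => w)).hasFDerivAt.comp_hasDerivAt τ h2
  rw [iteratedFDeriv_succ_apply_left]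
  exact h3

end taylor

/-! ### Local approximation up to the boundary -/

section approximation

/-- The weight of the class, tamed by the factor of Cauchy's remainder. -/
lemma pow_mul_weight_le {n u : ℕ} {γ x δ d : ℝ} (hu : 1 ≤ u) (hγ : 0 < γ) (hn : γ < n)
    (hx : 0 < x) (hx1 : x ≤ 1) (hδ : 0 < δ) (hδ1 : δ ≤ 1) (hd : x * δ ≤ d) (hd1 : d ≤ 1) :
    x ^ n * ((1 + |Real.log d ^ u|) / d ^ γ) ≤
      2 * (1 + u / (n - γ)) ^ u * ((1 + |Real.log δ|) ^ u * δ ^ (-γ)) := by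
  have hxδ : 0 < x * δ := mul_pos hx hδ
  have hd0 : 0 < d := hxδ.trans_le hd
  have hu0 : (0 : ℝ) < u := by exact_mod_cast hu
  have ha : 0 < (n : ℝ) - γ := by linarith
  have hlog : |Real.log d| ≤ |Real.log x| + |Real.log δ| := by
    rw [abs_of_nonpos (Real.log_nonpos hd0.le hd1), abs_of_nonpos (Real.log_nonpos hx.le hx1),
      abs_of_nonpos (Real.log_nonpos hδ.le hδ1)]
    have := Real.log_le_log hxδ hd
    rw [Real.log_mul hx.ne' hδ.ne'] at this
    linarith
  have hX := abs_nonneg (Real.log x)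
  have hD := abs_nonneg (Real.log δ)
  -- From `x δ ≤ d ≤ 1`, `|log d| ≤ |log x| + |log δ|`, which is less than `(1 + |log x|) (1 + |log
  -- δ|)`.
  have h1 : 1 + |Real.log d ^ u| ≤ 2 * ((1 + |Real.log x|) ^ u * (1 + |Real.log δ|) ^ u) := by
    rw [← mul_pow, abs_pow]
    have e1 : (1 : ℝ) ≤ ((1 + |Real.log x|) * (1 + |Real.log δ|)) ^ u :=
      one_le_pow₀ (by nlinarith)
    have e2 : |Real.log d| ^ u ≤ ((1 + |Real.log x|) * (1 + |Real.log δ|)) ^ u :=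
      pow_le_pow_left₀ (abs_nonneg _) (by nlinarith) u
    linarith
  have h2 : (d ^ γ)⁻¹ ≤ x ^ (-γ) * δ ^ (-γ) := by
    rw [← Real.rpow_neg hd0.le, ← Real.mul_rpow hx.le hδ.le]
    exact Real.rpow_le_rpow_of_nonpos hxδ hd (by linarith)
  -- The left side is the `u`-th power of `x^a (1 + |log x|)` with `a = (n - γ) / u > 0`, and `x^a
  -- |log x| < 1 / a` on `(0, 1]`.
  have h3 : x ^ n * x ^ (-γ) * (1 + |Real.log x|) ^ u ≤ (1 + u / (n - γ)) ^ u := by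
    have e1 : x ^ n * x ^ (-γ) = (x ^ (((n : ℝ) - γ) / u)) ^ u := by
      rw [← Real.rpow_mul_natCast hx.le, div_mul_cancel₀ _ hu0.ne', ← Real.rpow_natCast x n,
        ← Real.rpow_add hx, sub_eq_add_neg]
    rw [e1, ← mul_pow]
    have e2 := (Real.abs_log_mul_self_rpow_lt x _ hx hx1 (div_pos ha hu0)).le
    have e3 : x ^ (((n : ℝ) - γ) / u) ≤ 1 :=
      Real.rpow_le_one hx.le hx1 (div_pos ha hu0).le
    have e4 : 0 < x ^ (((n : ℝ) - γ) / u) := Real.rpow_pos_of_pos hx _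
    rw [abs_mul, abs_of_pos e4, one_div_div] at e2
    refine pow_le_pow_left₀ (by positivity) ?_ u
    linarith
  have hx' : 0 < x ^ (-γ) := Real.rpow_pos_of_pos hx _
  have hδ' : 0 < δ ^ (-γ) := Real.rpow_pos_of_pos hδ _
  calc x ^ n * ((1 + |Real.log d ^ u|) / d ^ γ)
      = x ^ n * ((1 + |Real.log d ^ u|) * (d ^ γ)⁻¹) := by rw [div_eq_mul_inv]
    _ ≤ x ^ n * (2 * ((1 + |Real.log x|) ^ u * (1 + |Real.log δ|) ^ u) *
          (x ^ (-γ) * δ ^ (-γ))) := by gcongr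
    _ = 2 * (x ^ n * x ^ (-γ) * (1 + |Real.log x|) ^ u) *
          ((1 + |Real.log δ|) ^ u * δ ^ (-γ)) := by ring
    _ ≤ _ := by gcongr

variable {l : ℕ}

lemma norm_line_le {x₀ y : Fin l → ℝ} {δ τ : ℝ} (hx₀ : ‖x₀‖ ≤ 1 - δ) (hy : ‖y‖ ≤ 1)
    (h0 : 0 ≤ τ) (h1 : τ ≤ 1) : ‖x₀ + τ • (y - x₀)‖ ≤ 1 - (1 - τ) * δ := by
  have : x₀ + τ • (y - x₀) = (1 - τ) • x₀ + τ • y := by module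
  rw [this]
  refine (norm_add_le _ _).trans ?_
  rw [norm_smul, norm_smul, Real.norm_eq_abs, Real.norm_eq_abs, abs_of_nonneg h0,
    abs_of_nonneg (by linarith)]
  nlinarith

/-- Local approximation by the Taylor polynomial, up to the boundary. -/
lemma abs_sub_taylorPoly_le (hl : 0 < l) {f : (Fin l → ℝ) → ℝ} {n u : ℕ} {γ : ℝ} (hu : 1 ≤ u)
    (hγ : 0 < γ) (hn : γ < n) (hcont : ContinuousOn f (cube l))
    (hdiff : ∀ k < n + 1, DifferentiableOn ℝ (iteratedFDeriv ℝ k f) (interior (cube l)))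
    (hbound : ∀ i : Fin (n + 1) → Fin l, ∀ t ∈ interior (cube l),
      |iteratedFDeriv ℝ (n + 1) f t (coordDirs i)| ≤ (1 + |Real.log (bdist t) ^ u|) / bdist t ^ γ)
    {x₀ : Fin l → ℝ} {δ h : ℝ} (hδ : 0 < δ) (hδ1 : δ ≤ 1) (hx₀ : ‖x₀‖ ≤ 1 - δ)
    {y : Fin l → ℝ} (hy : ‖y‖ ≤ 1) (hyh : ‖y - x₀‖ ≤ h) :
    |f y - MvPolynomial.eval y (taylorPoly f (n + 1) x₀)| ≤
      (l : ℝ) ^ (n + 1) * h ^ (n + 1) *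
        (2 * (1 + u / (n - γ)) ^ u * ((1 + |Real.log δ|) ^ u * δ ^ (-γ))) := by
  -- The derivatives are controlled only in the interior, so the estimate is proved there first. The
  -- point at parameter `ξ` of the segment from `x₀` to `y` has distance at least `(1 - ξ) δ` from
  -- `Γ`.
  have hinner : ∀ y : Fin l → ℝ, ‖y‖ < 1 → ‖y - x₀‖ ≤ h →
      |f y - MvPolynomial.eval y (taylorPoly f (n + 1) x₀)| ≤
      (l : ℝ) ^ (n + 1) * h ^ (n + 1) *
        (2 * (1 + u / (n - γ)) ^ u * ((1 + |Real.log δ|) ^ u * δ ^ (-γ))) := by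
    intro y hy hyh
    have hmem : ∀ τ ∈ Set.Icc (0 : ℝ) 1, x₀ + τ • (y - x₀) ∈ interior (cube l) := by
      intro τ hτ
      have h1 : x₀ + τ • (y - x₀) = (1 - τ) • x₀ + τ • y := by module
      rw [interior_cube, h1]
      exact convex_ball _ _ (mem_ball_zero_iff.2 (by linarith)) (mem_ball_zero_iff.2 hy)
        (by linarith [hτ.2]) hτ.1 (by ring)
    obtain ⟨ξ, hξ, heq⟩ := exists_taylor_cauchy
      (F := fun k τ => iteratedFDeriv ℝ k f (x₀ + τ • (y - x₀)) fun _ => y - x₀) n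
      fun k hk τ hτ => hasDerivAt_iteratedFDeriv_line
        ((hdiff k (by omega)).differentiableAt (isOpen_interior.mem_nhds (hmem τ hτ)))
    simp only [iteratedFDeriv_zero_apply, one_smul, zero_smul, add_zero, add_sub_cancel] at heq
    rw [eval_taylorPoly, heq]
    have hz := hmem ξ (Set.Ioo_subset_Icc_self hξ)
    have hzn := norm_line_le hx₀ hy.le hξ.1.le hξ.2.le
    set z := x₀ + ξ • (y - x₀)
    have hx : 0 < 1 - ξ := by linarith [hξ.2]
    have hz1 : ‖z‖ ≤ 1 := by nlinarith
    have hd := bdist_eq hl hz1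
    have hA := abs_multilinear_apply_le _ (fun i => hbound i z hz) hyh
    have hw := pow_mul_weight_le (d := bdist z) hu hγ hn hx (by linarith [hξ.1]) hδ hδ1
      (by rw [hd]; linarith) (by rw [hd]; linarith [norm_nonneg z])
    have hh : 0 ≤ h := (norm_nonneg _).trans hyh
    have hfac : (1 - ξ) ^ n / n.factorial ≤ (1 - ξ) ^ n :=
      div_le_self (by positivity) (by exact_mod_cast n.factorial_pos)
    rw [abs_mul, abs_of_nonneg (by positivity)]
    calc _ ≤ (1 - ξ) ^ n * ((l : ℝ) ^ (n + 1) * h ^ (n + 1) *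
          ((1 + |Real.log (bdist z) ^ u|) / bdist z ^ γ)) :=
          mul_le_mul hfac hA (abs_nonneg _) (by positivity)
      _ = (l : ℝ) ^ (n + 1) * h ^ (n + 1) *
          ((1 - ξ) ^ n * ((1 + |Real.log (bdist z) ^ u|) / bdist z ^ γ)) := by ring
      _ ≤ _ := by gcongr
  set p := taylorPoly f (n + 1) x₀
  have hline : Continuous fun τ : ℝ => x₀ + τ • (y - x₀) := by fun_prop
  have hmaps : Set.MapsTo (fun τ : ℝ => x₀ + τ • (y - x₀)) (Set.Icc 0 1) (cube l) := by
    intro τ hτ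
    rw [mem_cube_iff]
    refine (norm_line_le hx₀ hy hτ.1 hτ.2).trans ?_
    nlinarith [hτ.2]
  have hc : ContinuousOn (fun τ : ℝ => |f (x₀ + τ • (y - x₀)) -
      MvPolynomial.eval (x₀ + τ • (y - x₀)) p|) (Set.Icc 0 1) :=
    ((hcont.comp hline.continuousOn hmaps).sub
      ((MvPolynomial.continuous_eval p).comp hline).continuousOn).abs
  -- For `y` on `Γ` the segment from `x₀` stays inside until `τ = 1`; the continuity of `f` carries
  -- the bound to the limit.
  have hcl : (1 : ℝ) ∈ closure (Set.Ico (0 : ℝ) 1) := by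
    rw [closure_Ico zero_ne_one]
    exact ⟨zero_le_one, le_rfl⟩
  have := ContinuousWithinAt.closure_le hcl
    ((hc 1 ⟨zero_le_one, le_rfl⟩).mono Set.Ico_subset_Icc_self)
    (continuousWithinAt_const (b := (l : ℝ) ^ (n + 1) * h ^ (n + 1) *
        (2 * (1 + u / (n - γ)) ^ u * ((1 + |Real.log δ|) ^ u * δ ^ (-γ))))) fun τ hτ => by
      refine hinner _ ((norm_line_le hx₀ hy hτ.1 hτ.2.le).trans_lt ?_) ?_
      · nlinarith [hτ.2, mul_pos (sub_pos.2 hτ.2) hδ]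
      · rw [add_sub_cancel_left, norm_smul, Real.norm_eq_abs, abs_of_nonneg hτ.1]
        exact (mul_le_of_le_one_left (norm_nonneg _) hτ.2.le).trans hyh
  simpa using this

end approximation

/-! ### Widths of the layers -/

section width

variable {N : ℕ} {v : ℝ}

lemma layerWidth_eq (N : ℕ) (v : ℝ) (k : ℕ) :
    layerWidth N v k = (((k : ℝ) + 1) ^ v - (k : ℝ) ^ v) / (N : ℝ) ^ v := by
  rw [layerWidth, Real.div_rpow (by positivity) (by positivity),
    Real.div_rpow (by positivity) (by positivity), sub_div]

/-- Subtract `k^v ≤ (k+1)^(v-1) k` from `(k+1)^v = (k+1)^(v-1) (k+1)`. -/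
lemma rpow_sub_one_div_le_layerWidth (hv : 1 ≤ v) (k : ℕ) :
    ((k : ℝ) + 1) ^ (v - 1) / (N : ℝ) ^ v ≤ layerWidth N v k := by
  rw [layerWidth_eq]
  have hk : (0 : ℝ) ≤ k := k.cast_nonneg
  gcongr
  have h1 : ((k : ℝ) + 1) ^ v = ((k : ℝ) + 1) ^ (v - 1) * (k + 1) := by
    rw [← Real.rpow_add_one (by positivity), sub_add_cancel]
  have h2 : (k : ℝ) ^ v ≤ ((k : ℝ) + 1) ^ (v - 1) * k := by
    rcases Nat.eq_zero_or_pos k with rfl | hk'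
    · simp [Real.zero_rpow (by linarith : v ≠ 0)]
    · have hk0 : (0 : ℝ) < k := by exact_mod_cast hk'
      calc (k : ℝ) ^ v = (k : ℝ) ^ (v - 1) * k := by
            rw [← Real.rpow_add_one hk0.ne', sub_add_cancel]
        _ ≤ _ := by
            gcongr
            linarith
  linarith

lemma layerWidth_pos (hN : 0 < N) (hv : 1 ≤ v) (k : ℕ) : 0 < layerWidth N v k := by
  have : (0 : ℝ) < N := by exact_mod_cast hN
  exact lt_of_lt_of_le (by positivity) (rpow_sub_one_div_le_layerWidth hv k)

/-- Bernoulli's inequality gives `(1 - 1/(k+1))^v ≥ 1 - v/(k+1)`. -/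
lemma layerWidth_le (hN : 0 < N) (hv : 1 ≤ v) (k : ℕ) :
    layerWidth N v k ≤ v * (((k : ℝ) + 1) / N) ^ (v - 1) / N := by
  have hN' : (0 : ℝ) < N := by exact_mod_cast hN
  have hk : (0 : ℝ) < (k : ℝ) + 1 := by positivity
  have hx : 0 < ((k : ℝ) + 1) / N := by positivity
  have hb := one_add_mul_self_le_rpow_one_add (s := -(1 / ((k : ℝ) + 1)))
    (by rw [neg_le_neg_iff, div_le_one hk]; linarith [(k.cast_nonneg : (0 : ℝ) ≤ k)]) hv
  have h1 : (k : ℝ) / N = ((k : ℝ) + 1) / N * (1 + -(1 / ((k : ℝ) + 1))) := by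
    field_simp
    ring
  have h2 : 0 ≤ 1 + -(1 / ((k : ℝ) + 1)) := by
    have : 1 / ((k : ℝ) + 1) ≤ 1 := by
      rw [div_le_one hk]; linarith [(k.cast_nonneg : (0 : ℝ) ≤ k)]
    linarith
  have h3 : (((k : ℝ) + 1) / N) ^ v = (((k : ℝ) + 1) / N) ^ (v - 1) * (((k : ℝ) + 1) / N) := by
    rw [← Real.rpow_add_one hx.ne', sub_add_cancel]
  rw [layerWidth, h1, Real.mul_rpow hx.le h2]
  calc _ ≤ (((k : ℝ) + 1) / N) ^ v - (((k : ℝ) + 1) / N) ^ v * (1 + v * -(1 / ((k : ℝ) + 1))) := by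
        gcongr
    _ = _ := by
        rw [h3]
        field_simp
        ring

/-- Midpoint convexity of the power at `k`, `k + 1`, `k + 2`. -/
lemma layerWidth_monotone (hv : 1 ≤ v) : Monotone (layerWidth N v) := by
  refine monotone_nat_of_le_succ fun k => ?_
  rw [layerWidth_eq, layerWidth_eq]
  refine div_le_div_of_nonneg_right ?_ (by positivity)
  have hk : (0 : ℝ) ≤ k := k.cast_nonneg
  have h := (convexOn_rpow hv).2 (show (k : ℝ) ∈ Set.Ici 0 from hk)
    (show (k : ℝ) + 2 ∈ Set.Ici 0 from Set.mem_Ici.2 (by linarith))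
    (by norm_num : (0 : ℝ) ≤ 1 / 2) (by norm_num : (0 : ℝ) ≤ 1 / 2) (by norm_num)
  have e1 : (1 / 2 : ℝ) • (k : ℝ) + (1 / 2 : ℝ) • ((k : ℝ) + 2) = k + 1 := by
    simp only [smul_eq_mul]; ring
  simp only [e1] at h
  simp only [smul_eq_mul] at h
  have e2 : (((k + 1 : ℕ) : ℝ) + 1) = (k : ℝ) + 2 := by push_cast; ring
  rw [e2]
  push_cast
  linarith

/-- The widths of the layers, counted from the centre. -/
noncomputable def centralWidth (N : ℕ) (v : ℝ) (j : ℕ) : ℝ := layerWidth N v (N - 1 - j)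

lemma centralWidth_pos (hN : 0 < N) (hv : 1 ≤ v) (j : ℕ) : 0 < centralWidth N v j :=
  layerWidth_pos hN hv _

/-- Beyond level `N - 1` the truncated subtraction freezes the width at `h_0`, so that the
hypotheses on `η` hold at all levels. -/
lemma centralWidth_antitone (hv : 1 ≤ v) : Antitone (centralWidth N v) :=
  fun _ _ h => layerWidth_monotone hv (by omega)

lemma radius_centralWidth (hN : 0 < N) {p : ℕ} (hp : p ≤ N) :
    radius (centralWidth N v) p = 1 - (((N : ℝ) - p) / N) ^ v := by
  have hN' : (N : ℝ) ≠ 0 := by exact_mod_cast hN.ne'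
  induction p with
  | zero => simp [radius_zero, hN']
  | succ p ih =>
    have h : ((N - 1 - p : ℕ) : ℝ) = N - 1 - p := by
      rw [Nat.cast_sub (by omega), Nat.cast_sub (by omega), Nat.cast_one]
    rw [radius_succ, ih (by omega), centralWidth, layerWidth, h]
    push_cast
    rw [show (N : ℝ) - 1 - p + 1 = N - p by ring, show (N : ℝ) - (p + 1) = N - 1 - p by ring]
    ring

lemma radius_centralWidth_layer {k : ℕ} (hk : k < N) :
    radius (centralWidth N v) (N - 1 - k) = 1 - (((k : ℝ) + 1) / N) ^ v := by
  rw [radius_centralWidth (by omega) (by omega), Nat.cast_sub (by omega), Nat.cast_sub (by omega),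
    Nat.cast_one]
  congr 3
  ring

lemma radius_centralWidth_layer_succ {k : ℕ} (hk : k < N) :
    radius (centralWidth N v) (N - 1 - k + 1) = 1 - ((k : ℝ) / N) ^ v := by
  rw [show N - 1 - k + 1 = N - k by omega, radius_centralWidth (by omega) (by omega),
    Nat.cast_sub (by omega)]
  congr 3
  ring

lemma centralWidth_layer {k : ℕ} (hk : k < N) :
    centralWidth N v (N - 1 - k) = layerWidth N v k := by
  rw [centralWidth, show N - 1 - (N - 1 - k) = k by omega]

lemma mem_layer_iff {l : ℕ} (hl : 0 < l) {k : ℕ} (hk : k < N) {t : Fin l → ℝ} :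
    t ∈ layer l N v k ↔ radius (centralWidth N v) (N - 1 - k) ≤ ‖t‖ ∧
      ‖t‖ ≤ radius (centralWidth N v) (N - 1 - k + 1) := by
  rw [radius_centralWidth_layer hk, radius_centralWidth_layer_succ hk, layer, Set.mem_ofPred_eq,
    mem_cube_iff]
  constructor
  · rintro ⟨h1, h2, h3⟩
    rw [bdist_eq hl h1] at h2 h3
    constructor <;> linarith
  · rintro ⟨h1, h2⟩
    have h3 : 0 ≤ ((k : ℝ) / N) ^ v := by positivity
    have h4 : ‖t‖ ≤ 1 := by linarith
    rw [bdist_eq hl h4]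
    exact ⟨h4, by linarith, by linarith⟩

end width

/-! ### Boxes of a layer and their number -/

section boxes

variable {l : ℕ} {η : ℕ → ℝ}

/-- The lower and upper corners of a product of intervals. -/
def corners (I : Fin l → ℝ × ℝ) : (Fin l → ℝ) × (Fin l → ℝ) :=
  (fun i => (I i).1, fun i => (I i).2)

lemma corners_injective : Function.Injective (corners (l := l)) := by
  intro I J h
  rw [corners, corners, Prod.mk.injEq] at h
  exact funext fun i => Prod.ext (congrFun h.1 i) (congrFun h.2 i)

lemma mem_Icc_corners {I : Fin l → ℝ × ℝ} {t : Fin l → ℝ} :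
    t ∈ Set.Icc (corners I).1 (corners I).2 ↔ ∀ i, t i ∈ Set.Icc (I i).1 (I i).2 := by
  simp [corners, Set.mem_Icc, Pi.le_def, forall_and]

open Classical in
/-- The products of cells which make up the layer of level `j`. -/
noncomputable def shellProducts (l : ℕ) (η : ℕ → ℝ) (j : ℕ) : Finset (Fin l → ℝ × ℝ) :=
  (Fintype.piFinset fun _ => gridCells η j).filter fun I => ∃ i, I i ∈ endCells η j

lemma mem_shellProducts {j : ℕ} {I : Fin l → ℝ × ℝ} :
    I ∈ shellProducts l η j ↔ IsShellBox η j I := by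
  simp [shellProducts, IsShellBox]

/-- The boxes of the layer of level `j`. -/
noncomputable def shellBoxes (l : ℕ) (η : ℕ → ℝ) (j : ℕ) : Finset ((Fin l → ℝ) × (Fin l → ℝ)) :=
  (shellProducts l η j).map ⟨corners, corners_injective⟩

lemma mem_shellBoxes {j : ℕ} {Q : (Fin l → ℝ) × (Fin l → ℝ)} :
    Q ∈ shellBoxes l η j ↔ ∃ I, IsShellBox η j I ∧ corners I = Q := by
  simp [shellBoxes, mem_shellProducts]

lemma card_piFinset_update {α : Type*} [DecidableEq α] (A B : Finset α) (i : Fin l) :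
    (Fintype.piFinset (Function.update (fun _ : Fin l => A) i B)).card =
      B.card * A.card ^ (l - 1) := by
  rw [Fintype.card_piFinset, ← Finset.mul_prod_erase _ _ (Finset.mem_univ i),
    Function.update_self, Finset.prod_congr rfl (g := fun _ => A.card)]
  · simp
  · intro k hk
    rw [Function.update_of_ne (Finset.ne_of_mem_erase hk)]

/-- There are `l` choices of a coordinate carrying an end cell and at most two end cells; the other
`l - 1` cells are arbitrary. -/
lemma card_shellBoxes_le (j : ℕ) :
    (shellBoxes l η j).card ≤ l * (2 * (gridCells η j).card ^ (l - 1)) := by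
  rw [shellBoxes, Finset.card_map]
  have h : shellProducts l η j ⊆ Finset.univ.biUnion fun i => Fintype.piFinset
      (Function.update (fun _ : Fin l => gridCells η j) i (endCells η j)) := by
    intro I hI
    obtain ⟨h1, i, hi⟩ := mem_shellProducts.1 hI
    refine Finset.mem_biUnion.2 ⟨i, Finset.mem_univ i, Fintype.mem_piFinset.2 fun k => ?_⟩
    rcases eq_or_ne k i with rfl | hk
    · simpa using hi
    · simpa [hk] using h1 k
  refine (Finset.card_le_card h).trans (Finset.card_biUnion_le.trans ?_)
  refine (Finset.sum_le_card_nsmul _ _ (2 * (gridCells η j).card ^ (l - 1)) fun i _ => ?_).trans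
    (le_of_eq (by simp))
  rw [card_piFinset_update]
  exact Nat.mul_le_mul_right _ (card_endCells_le j)

lemma le_card_shellBoxes (hl : 0 < l) (j : ℕ) :
    (gridCells η j).card ^ (l - 1) ≤ (shellBoxes l η j).card := by
  rw [shellBoxes, Finset.card_map]
  let i : Fin l := ⟨0, hl⟩
  have h : Fintype.piFinset (Function.update (fun _ : Fin l => gridCells η j) i (endCells η j)) ⊆
      shellProducts l η j := by
    intro I hI
    rw [Fintype.mem_piFinset] at hI
    have hi : I i ∈ endCells η j := by simpa using hI i
    refine mem_shellProducts.2 ⟨fun k => ?_, i, hi⟩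
    rcases eq_or_ne k i with rfl | hk
    · exact endCells_subset_gridCells j hi
    · simpa [hk] using hI k
  refine le_trans ?_ (Finset.card_le_card h)
  rw [card_piFinset_update]
  exact Nat.le_mul_of_pos_left _ (endCells_nonempty j).card_pos

lemma card_shellBoxes_zero (hl : 0 < l) : (shellBoxes l η 0).card = 1 := by
  refine le_antisymm ?_ ?_
  · rw [shellBoxes, Finset.card_map, Finset.card_le_one]
    intro I hI J hJ
    refine funext fun i => ?_
    rw [mem_endCells_zero.1 ((mem_shellProducts.1 hI).1 i),
      mem_endCells_zero.1 ((mem_shellProducts.1 hJ).1 i)]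
  · simpa [gridCells, endCells] using le_card_shellBoxes (η := η) hl 0

lemma disjoint_interior_of_separated {I J : Fin l → ℝ × ℝ} {i : Fin l}
    (h : (I i).2 ≤ (J i).1 ∨ (J i).2 ≤ (I i).1) :
    Disjoint (interior (Set.Icc (corners I).1 (corners I).2))
      (interior (Set.Icc (corners J).1 (corners J).2)) := by
  rw [← Set.pi_univ_Icc, ← Set.pi_univ_Icc, interior_pi_set Set.finite_univ,
    interior_pi_set Set.finite_univ, Set.disjoint_left]
  intro t h1 h2
  have h1 := h1 i trivial
  have h2 := h2 i trivial
  simp only [corners, interior_Icc, Set.mem_Ioo] at h1 h2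
  rcases h with h | h <;> linarith

/-- A vertex on the outer surface of a layer is a vertex of the next layer. -/
lemma exists_shellBox_vertex (hη : ∀ j, 0 < η j) (hanti : Antitone η) (hl : 0 < l) {j : ℕ}
    {I : Fin l → ℝ × ℝ} (hI : IsShellBox η j I) {x : Fin l → ℝ} (hx : IsBoxVertex (corners I) x)
    (hxn : ‖x‖ = radius η (j + 1)) :
    ∃ J, IsShellBox η (j + 1) J ∧ IsBoxVertex (corners J) x := by
  choose J hJ hxJ using fun i => exists_endpoint_gridCells_succ hη hanti (hI.1 i) (hx i)
  obtain ⟨i, hi⟩ := exists_abs_eq_norm hl x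
  obtain ⟨K, hK, hxK⟩ := exists_endpoint_endCells_succ (hi.trans hxn)
  refine ⟨Function.update J i K, ⟨fun k => ?_, i, by simpa using hK⟩, fun k => ?_⟩
  · rcases eq_or_ne k i with rfl | hk
    · simpa using endCells_subset_gridCells _ hK
    · simpa [hk] using hJ k
  · rcases eq_or_ne k i with rfl | hk
    · simpa [corners] using hxK
    · simpa [corners, hk] using hxJ k

end boxes

/-! ### The graded partition and its number of nodes -/

section partition

variable {l N : ℕ} {v : ℝ}

/-- The graded partition whose one-dimensional sections are refined from the centre outwards. -/
noncomputable def gradedPartition (hl : 0 < l) (hv : 1 ≤ v) : GradedPartition l N v where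
  boxes k := shellBoxes l (centralWidth N v) (N - 1 - k)
  edge_ge k hk Q hQ i := by
    obtain ⟨I, hI, rfl⟩ := mem_shellBoxes.1 hQ
    rw [← centralWidth_layer hk]
    exact (gridCells_length (centralWidth_pos (by omega) hv) (centralWidth_antitone hv) _ _
      (hI.1 i)).1
  edge_le k hk Q hQ i := by
    obtain ⟨I, hI, rfl⟩ := mem_shellBoxes.1 hQ
    rw [← centralWidth_layer hk]
    exact (gridCells_length (centralWidth_pos (by omega) hv) (centralWidth_antitone hv) _ _
      (hI.1 i)).2
  cover k hk := by
    have hη := centralWidth_pos (N := N) (v := v) (by omega) hv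
    have hanti := centralWidth_antitone (N := N) hv
    ext t
    rw [mem_layer_iff hl hk, Set.mem_iUnion₂]
    constructor
    · rintro ⟨Q, hQ, htQ⟩
      obtain ⟨I, hI, rfl⟩ := mem_shellBoxes.1 hQ
      rw [mem_Icc_corners] at htQ
      exact ⟨hI.radius_le_norm htQ, norm_le_radius_of_mem hη hanti hI.1 htQ⟩
    · rintro ⟨h1, h2⟩
      obtain ⟨I, hI, htI⟩ := exists_shellBox hl hη hanti h1 h2
      exact ⟨corners I, mem_shellBoxes.2 ⟨I, hI, rfl⟩, mem_Icc_corners.2 htI⟩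
  disjoint k hk Q hQ Q' hQ' hne := by
    obtain ⟨I, hI, rfl⟩ := mem_shellBoxes.1 hQ
    obtain ⟨J, hJ, rfl⟩ := mem_shellBoxes.1 hQ'
    obtain ⟨i, hi⟩ := Function.ne_iff.1 fun h : I = J => hne (congrArg corners h)
    exact disjoint_interior_of_separated (gridCells_separated (centralWidth_pos (by omega) hv)
      (centralWidth_antitone hv) _ _ (hI.1 i) _ (hJ.1 i) hi)
  central k hk := by
    rw [show N - 1 - k = 0 by omega]
    exact card_shellBoxes_zero hl
  vertices k hk Q hQ x hx hxd := by
    have hη := centralWidth_pos (N := N) (v := v) (by omega) hv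
    have hanti := centralWidth_antitone (N := N) hv
    obtain ⟨I, hI, rfl⟩ := mem_shellBoxes.1 hQ
    have hmem : x ∈ Set.Icc (corners I).1 (corners I).2 := by
      refine mem_Icc_corners.2 fun i => ?_
      have := (gridCells_lt hη hanti (hI.1 i)).le
      rcases hx i with h | h <;> rw [h]
      · exact Set.left_mem_Icc.2 this
      · exact Set.right_mem_Icc.2 this
    have hxn := norm_le_radius_of_mem hη hanti hI.1 (mem_Icc_corners.1 hmem)
    rw [radius_centralWidth_layer_succ hk] at hxn
    have h0 : 0 ≤ (((k + 1 : ℕ) : ℝ) / N) ^ v := by positivity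
    rw [bdist_eq hl (by linarith)] at hxd
    obtain ⟨J, hJ, hJx⟩ := exists_shellBox_vertex hη hanti hl hI hx (by
      rw [radius_centralWidth_layer_succ hk]
      push_cast
      linarith)
    -- The layer `k` lies outside the layer `k + 1` and is the next level.
    rw [show N - 1 - (k + 1) + 1 = N - 1 - k by omega] at hJ
    exact ⟨corners J, mem_shellBoxes.2 ⟨J, hJ, rfl⟩, hJx⟩

/-- The cells have length at least `h_k ≥ (k+1)^(v-1) / N^v` and fill an interval of length at most
`2`. -/
lemma card_gridCells_layer_le (hN : 0 < N) (hv : 1 ≤ v) {k : ℕ} (hk : k < N) :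
    ((gridCells (centralWidth N v) (N - 1 - k)).card : ℝ) ≤
      2 * (N : ℝ) ^ v * ((k : ℝ) + 1) ^ (-(v - 1)) := by
  have hN' : (0 : ℝ) < N := by exact_mod_cast hN
  have h1 := card_gridCells_mul_le (centralWidth_pos hN hv) (centralWidth_antitone hv) (N - 1 - k)
  rw [centralWidth_layer hk, radius_centralWidth_layer_succ hk] at h1
  have h2 := rpow_sub_one_div_le_layerWidth (N := N) hv k
  have h0 : 0 ≤ ((k : ℝ) / N) ^ v := by positivity
  have h3 := mul_le_mul_of_nonneg_left h2
    (Nat.cast_nonneg (gridCells (centralWidth N v) (N - 1 - k)).card : (0 : ℝ) ≤ _)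
  rw [Real.rpow_neg (by positivity), ← div_eq_mul_inv, le_div_iff₀ (by positivity),
    ← div_le_iff₀ (by positivity), mul_div_assoc]
  linarith

/-- The outermost layer suffices: there `h_0 = N^(-v)` and the radius is `1`, so the grid has at
least `N^v` cells. -/
lemma rpow_le_numNodes (hl : 0 < l) (hN : 0 < N) (hv : 1 ≤ v) {m : ℕ} (hm : 0 < m) :
    (N : ℝ) ^ (v * ((l : ℝ) - 1)) ≤
      ((gradedPartition hl hv : GradedPartition l N v).numNodes m : ℝ) := by
  have hN' : (0 : ℝ) < N := by exact_mod_cast hN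
  have h1 := le_card_gridCells_mul (centralWidth_pos hN hv) (centralWidth_antitone hv) (N - 1 - 0)
  rw [centralWidth_layer hN, radius_centralWidth_layer_succ hN, layerWidth_eq] at h1
  rw [Nat.cast_zero, zero_add, zero_div, Real.one_rpow, Real.zero_rpow (by linarith), sub_zero,
    mul_one_div, le_div_iff₀ (by positivity), one_mul] at h1
  have h2 : (gridCells (centralWidth N v) (N - 1 - 0)).card ^ (l - 1) ≤
      (gradedPartition hl hv : GradedPartition l N v).numNodes m := by
    refine (le_card_shellBoxes hl _).trans ?_
    refine le_trans ?_ (Nat.le_mul_of_pos_left _ (pow_pos hm l))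
    exact Finset.single_le_sum (f := fun k => (shellBoxes l (centralWidth N v) (N - 1 - k)).card)
      (fun _ _ => Nat.zero_le _) (Finset.mem_range.2 hN)
  calc (N : ℝ) ^ (v * ((l : ℝ) - 1)) = ((N : ℝ) ^ v) ^ (l - 1) := by
        rw [← Real.rpow_mul_natCast hN'.le, Nat.cast_sub (by omega), Nat.cast_one]
    _ ≤ ((gridCells (centralWidth N v) (N - 1 - 0)).card : ℝ) ^ (l - 1) := by gcongr
    _ ≤ _ := by exact_mod_cast h2

lemma exists_numNodes_le (hl : 2 ≤ l) (hv : 1 ≤ v) (hvl : (l : ℝ) / (l - 1) < v) (m : ℕ) :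
    ∃ c : ℝ, 1 ≤ c ∧ ∀ N : ℕ, 0 < N →
      ((gradedPartition (by omega) hv : GradedPartition l N v).numNodes m : ℝ) ≤
        c * (N : ℝ) ^ (v * ((l : ℝ) - 1)) := by
  have hl1 : (1 : ℝ) ≤ (l : ℝ) - 1 := by
    have : (2 : ℝ) ≤ l := by exact_mod_cast hl
    linarith
  -- This is where `v > l / (l - 1)` enters: the box counts of the layers form a convergent series,
  -- so the outermost layers dominate.
  have hexp : 1 < (v - 1) * ((l : ℝ) - 1) := by
    rw [div_lt_iff₀ (by linarith)] at hvl
    linarith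
  have hsum : Summable fun k : ℕ => ((k : ℝ) + 1) ^ (-((v - 1) * ((l : ℝ) - 1))) := by
    have := (summable_nat_add_iff 1).2 (Real.summable_nat_rpow.2 (neg_lt_neg hexp))
    simpa using this
  set T := ∑' k : ℕ, ((k : ℝ) + 1) ^ (-((v - 1) * ((l : ℝ) - 1)))
  have hT : 0 ≤ T := tsum_nonneg fun k => by positivity
  set c := (m : ℝ) ^ l * (l * (2 * 2 ^ (l - 1))) * T
  -- A constant at least `1` lets `N ≤ n` be read off from `c N^a ≤ n` in the bound for the widths.
  refine ⟨max 1 c, le_max_left _ _, fun N hN => ?_⟩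
  have hN' : (0 : ℝ) < N := by exact_mod_cast hN
  refine le_trans ?_ (mul_le_mul_of_nonneg_right (le_max_right 1 c) (by positivity))
  have hl' : ((l - 1 : ℕ) : ℝ) = (l : ℝ) - 1 := by rw [Nat.cast_sub (by omega), Nat.cast_one]
  have hk : ∀ k ∈ Finset.range N, ((shellBoxes l (centralWidth N v) (N - 1 - k)).card : ℝ) ≤
      (l * (2 * 2 ^ (l - 1))) * (N : ℝ) ^ (v * ((l : ℝ) - 1)) *
        ((k : ℝ) + 1) ^ (-((v - 1) * ((l : ℝ) - 1))) := by
    intro k hk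
    have h1 := card_gridCells_layer_le hN hv (Finset.mem_range.1 hk)
    have h2 : ((shellBoxes l (centralWidth N v) (N - 1 - k)).card : ℝ) ≤
        l * (2 * ((gridCells (centralWidth N v) (N - 1 - k)).card : ℝ) ^ (l - 1)) := by
      exact_mod_cast card_shellBoxes_le (N - 1 - k)
    refine h2.trans ?_
    calc _ ≤ (l : ℝ) * (2 * (2 * (N : ℝ) ^ v * ((k : ℝ) + 1) ^ (-(v - 1))) ^ (l - 1)) := by gcongr
      _ = _ := by
        rw [mul_pow, mul_pow, ← Real.rpow_mul_natCast hN'.le,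
          ← Real.rpow_mul_natCast (by positivity), hl', neg_mul]
        ring
  calc ((gradedPartition (by omega) hv : GradedPartition l N v).numNodes m : ℝ)
      = (m : ℝ) ^ l * ∑ k ∈ Finset.range N,
          ((shellBoxes l (centralWidth N v) (N - 1 - k)).card : ℝ) := by
        rw [GradedPartition.numNodes]
        push_cast
        rfl
    _ ≤ (m : ℝ) ^ l * ((l * (2 * 2 ^ (l - 1))) * (N : ℝ) ^ (v * ((l : ℝ) - 1)) * T) := by
        gcongr
        refine (Finset.sum_le_sum hk).trans ?_
        rw [← Finset.mul_sum]
        gcongr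
        exact hsum.sum_le_tsum _ fun k _ => by positivity
    _ = _ := by ring

end partition

/-! ### The spline operator and its rank -/

section operator

variable {l m N : ℕ} {v : ℝ}

open Classical in
/-- The extension of a function on the cube by zero. -/
noncomputable def extendCube (f : C(cube l, ℝ)) (x : Fin l → ℝ) : ℝ :=
  if h : x ∈ cube l then f ⟨x, h⟩ else 0

lemma extendCube_coe (f : C(cube l, ℝ)) (t : cube l) : extendCube f t = f t := by
  rw [extendCube, dif_pos t.2]

lemma extendCube_add (f g : C(cube l, ℝ)) :
    extendCube (f + g) = extendCube f + extendCube g := by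
  ext x
  simp only [extendCube, Pi.add_apply]
  split_ifs <;> simp

lemma extendCube_smul (c : ℝ) (f : C(cube l, ℝ)) : extendCube (c • f) = c • extendCube f := by
  ext x
  simp only [extendCube, Pi.smul_apply]
  split_ifs <;> simp

lemma radius_centralWidth_eq_one (hN : 0 < N) (hv : 1 ≤ v) :
    radius (centralWidth N v) (N - 1 + 1) = 1 := by
  have := radius_centralWidth_layer_succ (v := v) hN
  rw [Nat.sub_zero] at this
  rw [this, Nat.cast_zero, zero_div, Real.zero_rpow (by linarith), sub_zero]

/-- The operator of interpolation by continuous local splines. -/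
noncomputable def splineOperator (l : ℕ) {m N : ℕ} {v : ℝ} (hN : 0 < N) (hv : 1 ≤ v) (hm : 2 ≤ m) :
    C(cube l, ℝ) →ₗ[ℝ] C(cube l, ℝ) where
  toFun f := ⟨fun t => spline m (centralWidth N v) (N - 1) (extendCube f) t, by
    have h := continuousOn_spline hm (centralWidth_pos hN hv) (centralWidth_antitone hv) (N - 1)
      (extendCube f)
    rw [radius_centralWidth_eq_one hN hv] at h
    exact h.comp_continuous continuous_subtype_val fun t => mem_cube_iff.1 t.2⟩
  map_add' f g := by
    ext t
    simp [extendCube_add, spline_add]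
  map_smul' c f := by
    ext t
    simp [extendCube_smul, spline_smul]

lemma splineOperator_apply (hN : 0 < N) (hv : 1 ≤ v) (hm : 2 ≤ m) (f : C(cube l, ℝ))
    (t : cube l) : splineOperator l hN hv hm f t =
      spline m (centralWidth N v) (N - 1) (extendCube f) t := rfl

lemma isInterpolatingSpline_splineOperator (hl : 0 < l) (hN : 0 < N) (hv : 1 ≤ v) (hm : 2 ≤ m)
    (f : C(cube l, ℝ)) :
    IsInterpolatingSpline (gradedPartition hl hv : GradedPartition l N v) m f
      (splineOperator l hN hv hm f) := by
  have hη := centralWidth_pos (N := N) (v := v) hN hv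
  have hanti := centralWidth_antitone (N := N) hv
  intro k hk Q hQ
  obtain ⟨I, hI, rfl⟩ := mem_shellBoxes.1 hQ
  have hS : ∀ t : cube l, (∀ i, (t : Fin l → ℝ) i ∈ Set.Icc (I i).1 (I i).2) →
      splineOperator l hN hv hm f t =
        spline m (centralWidth N v) (N - 1 - k) (extendCube f) t := fun t ht =>
    spline_of_norm_le hm hη hanti (by omega) _ (norm_le_radius_of_mem hη hanti hI.1 ht)
  constructor
  · obtain ⟨p, hp, h⟩ := exists_spline_eq_eval hm hη hanti (N - 1 - k) (extendCube f) hI.1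
    refine ⟨p, hp, fun t ht => ?_⟩
    rw [mem_Icc_corners] at ht
    rw [hS t ht, h t ht]
  · intro n t ht hd
    simp only [corners] at ht
    have hmem : ∀ i, (t : Fin l → ℝ) i ∈ Set.Icc (I i).1 (I i).2 := fun i => by
      rw [ht]
      exact chebNode_mem hm (gridCells_lt hη hanti (hI.1 i)).le _
    rw [hS t hmem, ← extendCube_coe f t, ht]
    refine spline_node hm hη hanti _ hI.1 n fun hj => ?_
    rw [← ht]
    -- A node at the inner radius would lie on the surface shared with `Δ^{k+1}`, which is excluded;
    -- `j ≠ 0` means `k + 1 < N`.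
    refine lt_of_le_of_ne (hI.radius_le_norm hmem) fun heq => hd (by omega) ?_
    rw [bdist_eq hl (mem_cube_iff.1 t.2), ← heq, radius_centralWidth_layer hk]
    ring

/-- As `S` vanishes on the kernel of `E`, it factors through the range of `E`. -/
lemma rank_le_card_of_forall_eq_zero {ι V W : Type} [Fintype ι] [AddCommGroup V] [Module ℝ V]
    [AddCommGroup W] [Module ℝ W] (S : V →ₗ[ℝ] W) (E : V →ₗ[ℝ] (ι → ℝ))
    (h : ∀ x, E x = 0 → S x = 0) : LinearMap.rank S ≤ (Fintype.card ι : Cardinal) := by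
  obtain ⟨g, hg⟩ := E.rangeRestrict.exists_rightInverse_of_surjective E.range_rangeRestrict
  have hS : S = (S ∘ₗ g) ∘ₗ E.rangeRestrict := by
    ext x
    have h1 : E (g (E.rangeRestrict x) - x) = 0 := by
      rw [map_sub, sub_eq_zero]
      exact congrArg Subtype.val (LinearMap.congr_fun hg (E.rangeRestrict x))
    have h2 := h _ h1
    rw [map_sub, sub_eq_zero] at h2
    exact h2.symm
  rw [hS]
  refine (LinearMap.rank_comp_le_left _ _).trans ((LinearMap.rank_le_domain _).trans
    ((Submodule.rank_le _).trans ?_))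
  rw [rank_fun']

lemma rank_splineOperator_le (hl : 0 < l) (hN : 0 < N) (hv : 1 ≤ v) (hm : 2 ≤ m) :
    LinearMap.rank (splineOperator l hN hv hm) ≤
      (((gradedPartition hl hv : GradedPartition l N v).numNodes m : ℕ) : Cardinal) := by
  -- Evaluation at all nodes, a node shared by several boxes being repeated; the index set thus has
  -- exactly `numNodes` elements.
  let E : C(cube l, ℝ) →ₗ[ℝ] ((Σ k : Fin N, shellProducts l (centralWidth N v) (N - 1 - k)) ×
      (Fin l → Fin m) → ℝ) :=
    { toFun := fun f p => extendCube f fun i =>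
        chebNode m (p.1.2.1 i).1 (p.1.2.1 i).2 (p.2 i)
      map_add' := fun f g => by
        ext p
        simp [extendCube_add]
      map_smul' := fun c f => by
        ext p
        simp [extendCube_smul] }
  refine (rank_le_card_of_forall_eq_zero _ E fun f hf => ?_).trans (le_of_eq ?_)
  · ext t
    refine spline_eq_zero hl hm (centralWidth_pos hN hv) (centralWidth_antitone hv) ?_ _ ?_
    · intro k hk I hI n
      refine congrFun hf ⟨⟨⟨N - 1 - k, by omega⟩, ⟨I, ?_⟩⟩, n⟩
      rw [mem_shellProducts, show N - 1 - (N - 1 - k) = k by omega]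
      exact hI
    · rw [radius_centralWidth_eq_one hN hv]
      exact mem_cube_iff.1 t.2
  · congr 1
    simp only [Fintype.card_prod, Fintype.card_sigma, Fintype.card_coe, Fintype.card_fun,
      Fintype.card_fin, GradedPartition.numNodes, gradedPartition, shellBoxes, Finset.card_map]
    rw [mul_comm, Finset.sum_range]

end operator

/-! ### Error of the spline on the class -/

section error

variable {l N : ℕ} {v : ℝ}

lemma exists_level (hN : 0 < N) (hv : 1 ≤ v) {t : Fin l → ℝ} (ht : ‖t‖ ≤ 1) :
    ∃ j ≤ N - 1, radius (centralWidth N v) j ≤ ‖t‖ ∧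
      ‖t‖ ≤ radius (centralWidth N v) (j + 1) := by
  classical
  have h : ∃ j, ‖t‖ ≤ radius (centralWidth N v) (j + 1) :=
    ⟨N - 1, by rwa [radius_centralWidth_eq_one hN hv]⟩
  refine ⟨Nat.find h, Nat.find_min' h (by rwa [radius_centralWidth_eq_one hN hv]), ?_,
    Nat.find_spec h⟩
  rcases Nat.eq_zero_or_pos (Nat.find h) with h0 | h0
  · rw [h0, radius_zero]
    exact norm_nonneg t
  · have := Nat.find_min h (Nat.sub_lt h0 one_pos)
    rw [show Nat.find h - 1 + 1 = Nat.find h by omega] at this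
    exact (not_le.1 this).le

/-- The grading balances the size of the boxes against the growth of the derivatives. -/
lemma layerWidth_pow_mul_le {s u k : ℕ} {γ : ℝ} (hγ : 0 < γ) (hs : γ < s)
    (hN : 2 ≤ N) (hk : k < N) (hv : v = s / (s - γ)) :
    layerWidth N v k ^ s * ((1 + |Real.log ((((k : ℝ) + 1) / N) ^ v / 2)|) ^ u *
      ((((k : ℝ) + 1) / N) ^ v / 2) ^ (-γ)) ≤
      v ^ s * 2 ^ γ * (v + 1 + 1 / Real.log 2) ^ u *
        ((N : ℝ) ^ (-(s : ℝ)) * Real.log N ^ u) := by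
  have hN2 : (2 : ℝ) ≤ N := by exact_mod_cast hN
  have hN0 : (0 : ℝ) < N := by linarith
  have hsγ : 0 < (s : ℝ) - γ := by linarith
  have hv1 : 1 ≤ v := by rw [hv, one_le_div hsγ]; linarith
  have hkN : (k : ℝ) + 1 ≤ N := by exact_mod_cast hk
  have hk0 : (0 : ℝ) ≤ k := k.cast_nonneg
  set x : ℝ := ((k : ℝ) + 1) / N with hx
  have hx0 : 0 < x := by positivity
  have hx1 : x ≤ 1 := by rw [hx, div_le_one hN0]; exact hkN
  have hlog2 : 0 < Real.log 2 := Real.log_pos one_lt_two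
  have hlogN : Real.log 2 ≤ Real.log N := Real.log_le_log two_pos hN2
  have h1 : layerWidth N v k ^ s * (x ^ v / 2) ^ (-γ) ≤ v ^ s * 2 ^ γ * (N : ℝ) ^ (-(s : ℝ)) := by
    have e1 : layerWidth N v k ^ s ≤ (v * x ^ (v - 1) / N) ^ s :=
      pow_le_pow_left₀ (layerWidth_pos (by omega) hv1 k).le (layerWidth_le (by omega) hv1 k) s
    have e2 : (v * x ^ (v - 1) / N) ^ s = v ^ s * x ^ ((v - 1) * s) * (N : ℝ) ^ (-(s : ℝ)) := by
      rw [div_pow, mul_pow, ← Real.rpow_mul_natCast hx0.le, Real.rpow_neg hN0.le,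
        Real.rpow_natCast, div_eq_mul_inv]
    have e3 : (x ^ v / 2) ^ (-γ) = x ^ (-(v * γ)) * 2 ^ γ := by
      rw [Real.div_rpow (by positivity) (by norm_num), ← Real.rpow_mul hx0.le,
        Real.rpow_neg two_pos.le, div_inv_eq_mul]
      congr 2
      ring
    -- The grading exponent is chosen for this cancellation: `v (s - γ) = s`.
    have e4 : x ^ ((v - 1) * s) * x ^ (-(v * γ)) = 1 := by
      rw [← Real.rpow_add hx0]
      have : (v - 1) * s + -(v * γ) = 0 := by
        have : v * (s - γ) = s := by rw [hv]; field_simp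
        linarith
      rw [this, Real.rpow_zero]
    calc _ ≤ (v * x ^ (v - 1) / N) ^ s * (x ^ v / 2) ^ (-γ) := by gcongr
      _ = v ^ s * 2 ^ γ * (N : ℝ) ^ (-(s : ℝ)) * (x ^ ((v - 1) * s) * x ^ (-(v * γ))) := by
        rw [e2, e3]; ring
      _ = _ := by rw [e4, mul_one]
  have h2 : 1 + |Real.log (x ^ v / 2)| ≤ (v + 1 + 1 / Real.log 2) * Real.log N := by
    have e1 : Real.log (x ^ v / 2) = v * Real.log x - Real.log 2 := by
      rw [Real.log_div (by positivity) two_ne_zero, Real.log_rpow hx0]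
    have e2 : -Real.log N ≤ Real.log x := by
      rw [hx, Real.log_div (by positivity) hN0.ne']
      have : 0 ≤ Real.log ((k : ℝ) + 1) := Real.log_nonneg (by linarith)
      linarith
    have e3 : Real.log x ≤ 0 := Real.log_nonpos hx0.le hx1
    -- As `N ≥ 2`, additive constants are absorbed into multiples of `log N`.
    have e4 : 1 ≤ 1 / Real.log 2 * Real.log N := by
      rw [one_div_mul_eq_div, le_div_iff₀ hlog2]; linarith
    have e5 : v * Real.log x ≤ 0 := mul_nonpos_of_nonneg_of_nonpos (by linarith) e3
    have e6 : v * -Real.log N ≤ v * Real.log x := mul_le_mul_of_nonneg_left e2 (by linarith)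
    rw [e1, abs_of_nonpos (by linarith)]
    linarith
  have hlw := (layerWidth_pos (N := N) (by omega) hv1 k).le
  calc _ = (layerWidth N v k ^ s * (x ^ v / 2) ^ (-γ)) * (1 + |Real.log (x ^ v / 2)|) ^ u := by ring
    _ ≤ (v ^ s * 2 ^ γ * (N : ℝ) ^ (-(s : ℝ))) * ((v + 1 + 1 / Real.log 2) * Real.log N) ^ u := by
      gcongr
    _ = _ := by rw [mul_pow]; ring

lemma norm_sub_midpoint_le (hN : 0 < N) (hv : 1 ≤ v) {j : ℕ} {I : Fin l → ℝ × ℝ}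
    (hI : ∀ i, I i ∈ gridCells (centralWidth N v) j) {t : Fin l → ℝ}
    (ht : ∀ i, t i ∈ Set.Icc (I i).1 (I i).2) :
    ‖t - fun i => ((I i).1 + (I i).2) / 2‖ ≤ centralWidth N v j := by
  have hη := centralWidth_pos (N := N) (v := v) hN hv
  refine (pi_norm_le_iff_of_nonneg (hη j).le).2 fun i => ?_
  have h1 := (gridCells_length hη (centralWidth_antitone hv) j _ (hI i)).2
  have h2 := ht i
  rw [Pi.sub_apply, Real.norm_eq_abs, abs_le]
  constructor <;> linarith [h2.1, h2.2]

lemma norm_midpoint_le (hN : 0 < N) (hv : 1 ≤ v) {k : ℕ} (hk : k < N) {I : Fin l → ℝ × ℝ}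
    (hI : ∀ i, I i ∈ gridCells (centralWidth N v) (N - 1 - k)) :
    ‖fun i => ((I i).1 + (I i).2) / 2‖ ≤ 1 - (((k : ℝ) + 1) / N) ^ v / 2 := by
  have hη := centralWidth_pos (N := N) (v := v) hN hv
  have hanti := centralWidth_antitone (N := N) hv
  have h1 := radius_nonneg hη (N - 1 - k)
  have h2 := radius_nonneg hη (N - 1 - k + 1)
  have h3 : 0 ≤ ((k : ℝ) / N) ^ v := by positivity
  have h4 := radius_centralWidth_layer (v := v) hk
  have h5 := radius_centralWidth_layer_succ (v := v) hk
  refine ((pi_norm_le_iff_of_nonneg (r := (radius (centralWidth N v) (N - 1 - k) +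
    radius (centralWidth N v) (N - 1 - k + 1)) / 2) (by positivity)).2 fun i =>
      abs_midpoint_le hη hanti (hI i)).trans ?_
  linarith

/-- The error of the spline on the functions of the class. -/
lemma exists_norm_sub_splineOperator_le {r u : ℕ} {γ : ℝ} (hl : 0 < l) (hu : 1 ≤ u) (hγ : 0 < γ)
    (hs : γ < (smoothOrder r γ : ℝ) - 1) (hm : 2 ≤ smoothOrder r γ) (hv : 1 ≤ gradExp r γ) :
    ∃ C : ℝ, 0 < C ∧ ∀ N : ℕ, ∀ hN : 2 ≤ N, ∀ g ∈ classQ l r u γ,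
      ‖g - splineOperator l (by omega : 0 < N) hv hm g‖ ≤
        C * ((N : ℝ) ^ (-(smoothOrder r γ : ℝ)) * Real.log N ^ u) := by
  -- `n = s - 1` is the exponent of `1 - ξ` in Cauchy's remainder.
  obtain ⟨n, hn⟩ : ∃ n, smoothOrder r γ = n + 1 := ⟨smoothOrder r γ - 1, by omega⟩
  have hnγ : γ < n := by
    rw [hn] at hs
    push_cast at hs
    linarith
  obtain ⟨M, hM0, hM⟩ := exists_bound_chebBasis hm
  set s := smoothOrder r γ with hsdef
  set v := gradExp r γ with hvdef
  have hlog2 : 0 < Real.log 2 := Real.log_pos one_lt_two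
  have hl0 : (0 : ℝ) < l := by exact_mod_cast hl
  have hn' : 0 < (n : ℝ) - γ := by linarith
  set K : ℝ := (l : ℝ) ^ (n + 1) * (2 * (1 + u / (n - γ)) ^ u) *
    (v ^ s * 2 ^ γ * (v + 1 + 1 / Real.log 2) ^ u) with hK
  have hK0 : 0 < K := by positivity
  refine ⟨(1 + (s : ℝ) ^ l * M ^ l) ^ 2 * K, by positivity, fun N hN g hg => ?_⟩
  have hN0 : 0 < N := by omega
  have hη := centralWidth_pos (N := N) (v := v) hN0 hv
  have hanti := centralWidth_antitone (N := N) hv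
  have hlogN : 0 ≤ Real.log N := Real.log_natCast_nonneg N
  have hε : 0 ≤ K * ((N : ℝ) ^ (-(s : ℝ)) * Real.log N ^ u) := by positivity
  obtain ⟨f, hgf, hcont, -, hdiff, hbound⟩ := hg
  have hfc : ContinuousOn f (cube l) := hcont.continuousOn
  have hext : ∀ x ∈ cube l, extendCube g x = f x := fun x hx => by
    rw [← hgf ⟨x, hx⟩, ← extendCube_coe]
  rw [ContinuousMap.norm_le _ (by positivity)]
  intro t
  have ht1 := mem_cube_iff.1 t.2
  obtain ⟨j, hj, hj1, hj2⟩ := exists_level hN0 hv ht1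
  rw [ContinuousMap.sub_apply, splineOperator_apply, spline_of_norm_le hm hη hanti hj _ hj2,
    ← extendCube_coe, Real.norm_eq_abs, mul_assoc]
  refine abs_sub_spline_le hl hm hη hanti hM0.le hM hε ?_ hj1 hj2
  intro i hi I hI
  obtain ⟨k, hk, rfl⟩ : ∃ k < N, i = N - 1 - k := ⟨N - 1 - i, by omega, by omega⟩
  refine ⟨_, taylorPoly_mem f s fun i => ((I i).1 + (I i).2) / 2, fun x hx => ?_⟩
  have hx1 : ‖x‖ ≤ 1 := by
    rw [← radius_centralWidth_eq_one hN0 hv]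
    exact (norm_le_radius_of_mem hη hanti hI.1 hx).trans
      ((radius_strictMono hη).monotone (by omega))
  have hkN : (k : ℝ) + 1 ≤ N := by exact_mod_cast hk
  have hD0 : 0 < (((k : ℝ) + 1) / N) ^ v := by positivity
  have hD1 : (((k : ℝ) + 1) / N) ^ v ≤ 1 :=
    Real.rpow_le_one (by positivity) (div_le_one_of_le₀ hkN (by positivity)) (by linarith)
  rw [hext x (mem_cube_iff.2 hx1), hn]
  have hexp : ((n + 1 : ℕ) : ℝ) - r - zetaPar γ = γ := by
    rw [← hn, hsdef, smoothOrder, zetaPar]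
    push_cast
    ring
  have hrs : r < n + 1 := by
    rw [← hn, hsdef, smoothOrder]
    have := Nat.ceil_pos.2 hγ
    omega
  have hlocal := abs_sub_taylorPoly_le hl hu hγ hnγ hfc (fun k hk => hdiff k (by omega))
    (fun i t ht => by
      have := hbound (n + 1) hrs hn.ge i t ht
      rwa [hexp] at this)
    (half_pos hD0) (by linarith) (norm_midpoint_le hN0 hv hk hI.1) hx1
    (norm_sub_midpoint_le hN0 hv hI.1 hx)
  refine hlocal.trans ?_
  have hnum := layerWidth_pow_mul_le (u := u) hγ (by linarith : γ < s) hN hk hvdef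
  rw [centralWidth_layer hk]
  rw [hn] at hnum
  calc _ = (l : ℝ) ^ (n + 1) * (2 * (1 + u / (n - γ)) ^ u) * (layerWidth N v k ^ (n + 1) *
        ((1 + |Real.log ((((k : ℝ) + 1) / N) ^ v / 2)|) ^ u *
          ((((k : ℝ) + 1) / N) ^ v / 2) ^ (-γ))) := by ring
    _ ≤ _ := mul_le_mul_of_nonneg_left hnum (by positivity)
    _ = _ := by rw [hK, hn]; ring

end error

/-! ### Kolmogorov widths -/

section kolmogorov

/-- The width admits subspaces of dimension exactly `n`, whereas the range of the operator may be
smaller; one vector at a time is added. -/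
lemma exists_submodule_finrank_eq {B : Type*} [AddCommGroup B] [Module ℝ B]
    (hB : ¬ FiniteDimensional ℝ B) (L : Submodule ℝ B) [FiniteDimensional ℝ L] {n : ℕ}
    (hn : Module.finrank ℝ L ≤ n) :
    ∃ L' : Submodule ℝ B, L ≤ L' ∧ FiniteDimensional ℝ L' ∧ Module.finrank ℝ L' = n := by
  induction n, hn using Nat.le_induction with
  | base => exact ⟨L, le_rfl, inferInstance, rfl⟩
  | succ n _ ih =>
    obtain ⟨L', hL, hfin, hrank⟩ := ih
    obtain ⟨x, hx⟩ : ∃ x, x ∉ L' := by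
      by_contra! h
      have htop : L' = ⊤ := Submodule.eq_top_iff'.2 h
      rw [htop] at hfin
      exact hB (Module.finite_def.2 (Submodule.fg_top _ |>.1 (Module.finite_def.1 hfin)))
    have hx0 : x ≠ 0 := fun h => hx (h ▸ L'.zero_mem)
    refine ⟨L' ⊔ Submodule.span ℝ {x}, hL.trans le_sup_left, inferInstance, ?_⟩
    have h1 := Submodule.finrank_sup_add_finrank_inf_eq L' (Submodule.span ℝ {x})
    have h2 : L' ⊓ Submodule.span ℝ {x} = ⊥ :=
      disjoint_iff.1 ((Submodule.disjoint_span_singleton' hx0).2 hx)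
    rw [h2, finrank_bot, hrank, finrank_span_singleton hx0] at h1
    exact h1

/-- Polynomials in one coordinate embed in the space. -/
lemma not_finiteDimensional_continuousMap_cube {l : ℕ} (hl : 0 < l) :
    ¬ FiniteDimensional ℝ C(cube l, ℝ) := by
  intro h
  let i : Fin l := ⟨0, hl⟩
  let E : Polynomial ℝ →ₗ[ℝ] C(cube l, ℝ) :=
    { toFun := fun p => ⟨fun t => p.eval ((t : Fin l → ℝ) i), by
        exact p.continuous.comp ((continuous_apply i).comp continuous_subtype_val)⟩
      map_add' := fun p q => by ext t; simp
      map_smul' := fun c p => by ext t; simp }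
  have hE : Function.Injective E := by
    rw [← LinearMap.ker_eq_bot, LinearMap.ker_eq_bot']
    intro p hp
    refine Polynomial.eq_zero_of_infinite_isRoot p
      ((Set.Icc_infinite (show (-1 : ℝ) < 1 by norm_num)).mono fun x hx => ?_)
    exact ContinuousMap.congr_fun hp ⟨fun _ => x, fun _ => hx.1, fun _ => hx.2⟩
  exact Polynomial.not_finite (Module.Finite.of_injective E hE)

lemma kolmogorovWidth_le {B : Type*} [NormedAddCommGroup B] [NormedSpace ℝ B]
    (hB : ¬ FiniteDimensional ℝ B) {X : Set B} {n : ℕ} {ε : ℝ} (L : Submodule ℝ B)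
    [FiniteDimensional ℝ L] (hn : Module.finrank ℝ L ≤ n) (h : ∀ x ∈ X, ∃ y ∈ L, ‖x - y‖ ≤ ε) :
    kolmogorovWidth n X ≤ ENNReal.ofReal ε := by
  obtain ⟨L', hL, hfin, hrank⟩ := exists_submodule_finrank_eq hB L hn
  refine (iInf₂_le L' ⟨hfin, hrank⟩).trans (iSup₂_le fun x hx => ?_)
  obtain ⟨y, hy, hxy⟩ := h x hx
  refine (iInf₂_le y (hL hy)).trans ?_
  rw [← ofReal_norm]
  exact ENNReal.ofReal_le_ofReal hxy

lemma norm_le_one_of_mem_classQ {l r u : ℕ} {γ : ℝ} {g : C(cube l, ℝ)}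
    (hg : g ∈ classQ l r u γ) : ‖g‖ ≤ 1 := by
  obtain ⟨f, hgf, -, hbound, -⟩ := hg
  refine (ContinuousMap.norm_le _ zero_le_one).2 fun t => ?_
  have := hbound 0 (Nat.zero_le r) Fin.elim0 t t.2
  rwa [iteratedFDerivWithin_zero_apply, ← hgf] at this

end kolmogorov

/-! ### Assembly and choice of the constants -/

theorem theorem3p9 (l r u : ℕ) (γ : ℝ) (hl : 2 ≤ l) (hr : 1 ≤ r) (hu : 1 ≤ u)
    (hγ : 0 < γ) (hγ_nonint : ∀ m : ℤ, γ ≠ m)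
    (hv : (l : ℝ) / ((l : ℝ) - 1) < gradExp r γ) :
    ∃ c : ℝ, 0 < c ∧
      (∀ n : ℕ, 2 ≤ n →
        kolmogorovWidth n (classQ l r u γ) ≤
          ENNReal.ofReal
            (c * (n : ℝ) ^ (-(((smoothOrder r γ : ℝ) - γ) / ((l : ℝ) - 1))) * Real.log n ^ u)) ∧
      (∀ N : ℕ, 2 ≤ N →
        ∃ (P : GradedPartition l N (gradExp r γ)) (n : ℕ),
          n = P.numNodes (smoothOrder r γ) ∧
          c⁻¹ * (N : ℝ) ^ (gradExp r γ * ((l : ℝ) - 1)) ≤ (n : ℝ) ∧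
          (n : ℝ) ≤ c * (N : ℝ) ^ (gradExp r γ * ((l : ℝ) - 1)) ∧
          ∃ S : C(cube l, ℝ) →ₗ[ℝ] C(cube l, ℝ),
            LinearMap.rank S ≤ (n : Cardinal) ∧
            (∀ f, IsInterpolatingSpline P (smoothOrder r γ) f (S f)) ∧
            ∀ f ∈ classQ l r u γ,
              ‖f - S f‖ ≤
                c * (n : ℝ) ^ (-(((smoothOrder r γ : ℝ) - γ) / ((l : ℝ) - 1))) *
                  Real.log n ^ u) := by
  have hl0 : 0 < l := by omega
  have hl1 : (1 : ℝ) ≤ (l : ℝ) - 1 := by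
    have : (2 : ℝ) ≤ l := by exact_mod_cast hl
    linarith
  have hceil := Nat.ceil_pos.2 hγ
  have hm : 2 ≤ smoothOrder r γ := by rw [smoothOrder]; omega
  have hs : γ < (smoothOrder r γ : ℝ) - 1 := by
    have h1 : γ < (⌈γ⌉₊ : ℝ) :=
      lt_of_le_of_ne (Nat.le_ceil γ) fun h => hγ_nonint ⌈γ⌉₊ (by exact_mod_cast h)
    have h2 : (1 : ℝ) ≤ r := by exact_mod_cast hr
    rw [smoothOrder]
    push_cast
    linarith
  have hv1 : 1 ≤ gradExp r γ := by
    rw [gradExp, one_le_div (by linarith)]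
    linarith
  obtain ⟨C, hC, herr⟩ := exists_norm_sub_splineOperator_le (r := r) (u := u) hl0 hu hγ hs hm hv1
  obtain ⟨c₁, hc₁, hnodes⟩ := exists_numNodes_le hl hv1 hv (smoothOrder r γ)
  have hab : gradExp r γ * ((l : ℝ) - 1) * (((smoothOrder r γ : ℝ) - γ) / ((l : ℝ) - 1)) =
      smoothOrder r γ := by
    have h1 : (smoothOrder r γ : ℝ) - γ ≠ 0 := by linarith
    have h2 : (l : ℝ) - 1 ≠ 0 := by linarith
    rw [gradExp]
    field_simp
  have ha : 1 ≤ gradExp r γ * ((l : ℝ) - 1) := by nlinarith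
  have hb : 0 < ((smoothOrder r γ : ℝ) - γ) / ((l : ℝ) - 1) :=
    div_pos (by linarith) (by linarith)
  set s := smoothOrder r γ
  set v := gradExp r γ
  set a := v * ((l : ℝ) - 1)
  set b := ((s : ℝ) - γ) / ((l : ℝ) - 1)
  have hlog2 : 0 < Real.log 2 := Real.log_pos one_lt_two
  -- `c₂` serves the spline estimates and `c₃` the widths for small `n`. The factor `2^s` pays for
  -- rounding `N` down in the first assertion.
  set c₂ := C * c₁ ^ b * 2 ^ (s : ℝ)
  set c₃ := (c₁ * 2 ^ a) ^ b / Real.log 2 ^ u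
  have hc₁0 : 0 < c₁ := by linarith
  have hc₂0 : 0 < c₂ := by positivity
  have hc₃0 : 0 < c₃ := by positivity
  have hle : ∀ N : ℕ, 0 < N → (N : ℝ) ≤ (N : ℝ) ^ a := fun N hN =>
    Real.self_le_rpow_of_one_le (by exact_mod_cast hN) ha
  refine ⟨c₁ + c₂ + c₃, by positivity, fun n hn => ?_, fun N hN => ?_⟩
  · have hn2 : (2 : ℝ) ≤ n := by exact_mod_cast hn
    have hn0 : (0 : ℝ) < n := by linarith
    have hlogn : Real.log 2 ≤ Real.log n := Real.log_le_log two_pos hn2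
    have hlogn0 : 0 < Real.log n := by linarith
    have hB := not_finiteDimensional_continuousMap_cube hl0
    rcases lt_or_ge (n : ℝ) (c₁ * 2 ^ a) with h | h
    -- Here `n` may be too small for a spline with `N = 2`. The zero subspace gives the error `1`,
    -- and `c₃` is chosen so that the claimed bound is at least `1`.
    · refine (kolmogorovWidth_le (ε := 1) hB ⊥ (by simp) fun g hg =>
        ⟨0, Submodule.zero_mem _, by simpa using norm_le_one_of_mem_classQ hg⟩).trans
        (ENNReal.ofReal_le_ofReal ?_)
      calc (1 : ℝ) = c₃ * (c₁ * 2 ^ a) ^ (-b) * Real.log 2 ^ u := by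
            rw [Real.rpow_neg (by positivity)]
            simp only [c₃]
            field_simp
        _ ≤ c₃ * (n : ℝ) ^ (-b) * Real.log n ^ u := by
            have := Real.rpow_le_rpow_of_nonpos hn0 h.le (neg_nonpos.2 hb.le)
            gcongr
        _ ≤ _ := by
            gcongr
            linarith
    -- `N = ⌊x⌋₊` is the largest integer with `c₁ N^a ≤ n`, so the spline has at most `n` nodes.
    -- From `2 ≤ x` follows `N ≥ x / 2`, and `a b = s` turns `N^(-s)` into a multiple of `n^(-b)`.
    · set x := ((n : ℝ) / c₁) ^ a⁻¹
      have hx0 : 0 < x := by positivity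
      have hxa : x ^ a = n / c₁ := Real.rpow_inv_rpow (by positivity) (by linarith)
      have hx2 : 2 ≤ x := by
        rw [← Real.rpow_le_rpow_iff two_pos.le hx0.le (by linarith : 0 < a), hxa,
          le_div_iff₀ hc₁0, mul_comm]
        exact h
      have hN2 : 2 ≤ ⌊x⌋₊ := Nat.le_floor (by exact_mod_cast hx2)
      have hNx : (⌊x⌋₊ : ℝ) ≤ x := Nat.floor_le hx0.le
      have hxN : x < ⌊x⌋₊ + 1 := Nat.lt_floor_add_one x
      set N := ⌊x⌋₊
      have hN2' : (2 : ℝ) ≤ N := by exact_mod_cast hN2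
      have hN0 : 0 < N := by omega
      have hNn : c₁ * (N : ℝ) ^ a ≤ n := by
        have := Real.rpow_le_rpow (by positivity) hNx (by linarith : 0 ≤ a)
        rwa [hxa, le_div_iff₀ hc₁0, mul_comm] at this
      have hlogNn : Real.log N ≤ Real.log n := by
        refine Real.log_le_log (by linarith) ((hle N hN0).trans (le_trans ?_ hNn))
        exact le_mul_of_one_le_left (by positivity) hc₁
      have hlogN : 0 ≤ Real.log N := Real.log_natCast_nonneg N
      have hNs : (N : ℝ) ^ (-(s : ℝ)) ≤ c₁ ^ b * 2 ^ (s : ℝ) * (n : ℝ) ^ (-b) := by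
        calc (N : ℝ) ^ (-(s : ℝ)) ≤ (x / 2) ^ (-(s : ℝ)) :=
              Real.rpow_le_rpow_of_nonpos (by positivity) (by linarith)
                (neg_nonpos.2 (Nat.cast_nonneg s))
          _ = (x ^ a) ^ (-b) * 2 ^ (s : ℝ) := by
              rw [Real.div_rpow hx0.le two_pos.le, Real.rpow_neg two_pos.le, div_inv_eq_mul,
                ← Real.rpow_mul hx0.le, mul_neg, hab]
          _ = _ := by
              rw [hxa, Real.div_rpow hn0.le hc₁0.le, Real.rpow_neg hc₁0.le, div_inv_eq_mul]
              ring
      have hrank := (rank_splineOperator_le hl0 hN0 hv1 hm).trans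
        (Nat.cast_le.2 (Nat.cast_le.1 ((hnodes N hN0).trans hNn)))
      have hfin : FiniteDimensional ℝ (splineOperator l hN0 hv1 hm).range :=
        Module.rank_lt_aleph0_iff.1 (hrank.trans_lt Cardinal.natCast_lt_aleph0)
      refine (kolmogorovWidth_le hB (splineOperator l hN0 hv1 hm).range
        (Module.finrank_le_of_rank_le hrank) fun g hg =>
          ⟨_, LinearMap.mem_range_self _ g, herr N hN2 g hg⟩).trans (ENNReal.ofReal_le_ofReal ?_)
      calc _ ≤ C * (c₁ ^ b * 2 ^ (s : ℝ) * (n : ℝ) ^ (-b) * Real.log n ^ u) := by gcongr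
        _ = c₂ * (n : ℝ) ^ (-b) * Real.log n ^ u := by ring
        _ ≤ _ := by
            gcongr
            linarith
  · have hN0 : 0 < N := by omega
    have hN0' : (0 : ℝ) < N := by exact_mod_cast hN0
    have hlower := rpow_le_numNodes (N := N) hl0 hN0 hv1 (by omega : 0 < s)
    have hupper := hnodes N hN0
    have hlogN : 0 ≤ Real.log N := Real.log_natCast_nonneg N
    refine ⟨gradedPartition hl0 hv1, _, rfl, ?_, ?_, splineOperator l hN0 hv1 hm,
      rank_splineOperator_le hl0 hN0 hv1 hm,
      isInterpolatingSpline_splineOperator hl0 hN0 hv1 hm, fun g hg => (herr N hN g hg).trans ?_⟩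
    · refine le_trans ?_ hlower
      exact mul_le_of_le_one_left (by positivity) (inv_le_one_of_one_le₀ (by linarith))
    · refine hupper.trans ?_
      gcongr
      linarith
    · set n := (gradedPartition hl0 hv1 : GradedPartition l N v).numNodes s
      have hn0 : (0 : ℝ) < n := lt_of_lt_of_le (by positivity) hlower
      have hlogNn : Real.log N ≤ Real.log n := Real.log_le_log hN0' ((hle N hN0).trans hlower)
      have hNs : (N : ℝ) ^ (-(s : ℝ)) ≤ c₁ ^ b * (n : ℝ) ^ (-b) := by
        have h1 : (n : ℝ) / c₁ ≤ (N : ℝ) ^ a := by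
          rw [div_le_iff₀ hc₁0, mul_comm]
          exact hupper
        have h2 := Real.rpow_le_rpow_of_nonpos (by positivity) h1 (neg_nonpos.2 hb.le)
        rw [← Real.rpow_mul hN0'.le, mul_neg, hab, Real.div_rpow hn0.le hc₁0.le,
          Real.rpow_neg hc₁0.le, div_inv_eq_mul] at h2
        linarith
      have h2s : (1 : ℝ) ≤ 2 ^ (s : ℝ) := Real.one_le_rpow one_le_two (Nat.cast_nonneg s)
      have hlogn : 0 ≤ Real.log n := hlogN.trans hlogNn
      calc _ ≤ C * (c₁ ^ b * (n : ℝ) ^ (-b) * Real.log n ^ u) := by gcongr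
        _ = C * c₁ ^ b * 1 * (n : ℝ) ^ (-b) * Real.log n ^ u := by ring
        _ ≤ c₂ * (n : ℝ) ^ (-b) * Real.log n ^ u := by
            simp only [c₂]
            gcongr
        _ ≤ _ := by
            gcongr
            linarith
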